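/- For $g\in L^2(\mathbb R)$ write $\hat g$ for its Fourier transform, normalised by $\hat g(\xi)=\int_{\mathbb R} g(t)e^{-2\pi i\xi t}\,dt$ on integrable functions, and let $G(g)=\{e^{2\pi i n t}g(t-m)\}_{(m,n)\in\mathbb Z^2}$. We say that $G(g)$ is a Riesz basis with bounds $A,B>0$ if it is complete in $L^2(\mathbb R)$ and, for every $(a_{m,n})\in\ell^2(\mathbb Z^2)$, the series $\sum a_{m,n}e^{2\pi i n t}g(t-m)$ converges unconditionally in $L^2(\mathbb R)$ with $$A\sum|a_{m,n}|^2\le\Big\|\sum a_{m,n}e^{2\pi i n t}g(t-m)\Big\|_{L^2(\mathbb R)}^2\le B\sum|a_{m,n}|^2 .$$ **Theorem.** For all $A,B>0$ there is a constant $C=C(A,B)>0$ such that, for every $g\in L^2(\mathbb R)$ for which $G(g)$ is a Riesz basis with bounds $A,B$, the following hold. 1. For all $1\le p\le 2$ and $q\in[2,\infty]$ with $\frac1p+\frac1q=1$, and all real $R,L\ge 1$, $$\sum_{k\in\mathbb Z,\,|k|>R}\|g\|_{L^q(k,k+1)}^p+\sum_{k\in\mathbb Z,\,|k|>L}\|\hat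 g\|_{L^q(k,k+1)}^p>\frac{C}{(RL)^{p/q}},$$ where the sums take values in $[0,\infty]$ and $p/q=0$ if $q=\infty$. 2. (Recovered by the case $p=q=2$.) For all real $R,L\ge1$, $$\int_{|t|\ge R}|g(t)|^2\,dt+\int_{|\xi|\ge L}|\hat g(\xi)|^2\,d\xi\ge\frac{C}{RL}.$$ 3. (Recovered by the case $p=1$, $q=\infty$; the Amalgam Balian–Low theorem.) $$\sum_{k\in\mathbb Z}\|g\|_{L^\infty(k,k+1)}=\infty\quad\text{or}\quad\sum_{k\in\mathbb Z}\|\hat g\|_{L^\infty(k,k+1)}=\infty .$$ -/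

import Mathlib

open MeasureTheory
open scoped ENNReal FourierTransform

noncomputable section

/-- The family `f` in the Hilbert space `H` is a Riesz basis, and `A`, `B` are admissible
constants for it: `f` is complete, and for every square-summable sequence `a` the series
`∑ aᵢ fᵢ` converges (unconditionally) in `H` and
`A ∑ |aᵢ|² ≤ ‖∑ aᵢ fᵢ‖² ≤ B ∑ |aᵢ|²`. -/
structure IsRieszBasisWithBounds {ι H : Type*} [NormedAddCommGroup H] [InnerProductSpace ℂ H]
    [CompleteSpace H] (A B : ℝ) (f : ι → H) : Prop where
  lower_pos : 0 < A
  upper_pos : 0 < B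
  complete : (Submodule.span ℂ (Set.range f)).topologicalClosure = ⊤
  summable : ∀ a : lp (fun _ : ι => ℂ) 2, Summable fun i => a i • f i
  lower : ∀ a : lp (fun _ : ι => ℂ) 2, A * ∑' i, ‖a i‖ ^ 2 ≤ ‖∑' i, a i • f i‖ ^ 2
  upper : ∀ a : lp (fun _ : ι => ℂ) 2, ‖∑' i, a i • f i‖ ^ 2 ≤ B * ∑' i, ‖a i‖ ^ 2

/-- The time-frequency shift `t ↦ e^{2πint} g(t - m)`. -/
def timeFreqShift (g : ℝ → ℂ) (m n : ℤ) (t : ℝ) : ℂ :=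
  Complex.exp (2 * (Real.pi : ℂ) * Complex.I * (n : ℂ) * (t : ℂ)) * g (t - m)

theorem memLp_timeFreqShift {g : ℝ → ℂ} (hg : MemLp g 2 volume) (m n : ℤ) :
    MemLp (timeFreqShift g m n) 2 volume := by
  have h1 : MemLp (fun t : ℝ => g (t - m)) 2 volume :=
    hg.comp_measurePreserving (measurePreserving_sub_right volume (m : ℝ))
  refine h1.of_le ?_ (Filter.Eventually.of_forall fun t => ?_)
  · refine AEStronglyMeasurable.mul ?_ h1.aestronglyMeasurable
    exact Continuous.aestronglyMeasurable (by fun_prop)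
  · have : (2 * (Real.pi : ℂ) * Complex.I * (n : ℂ) * (t : ℂ))
        = ((2 * Real.pi * n * t : ℝ) : ℂ) * Complex.I := by push_cast; ring
    rw [timeFreqShift, norm_mul, this, Complex.norm_exp_ofReal_mul_I, one_mul]

/-- The Gabor system `G(g) = {e^{2πint} g(t - m)}`, indexed by `(m, n) ∈ ℤ × ℤ`, in `L²(ℝ)`. -/
def gaborSystem (g : Lp ℂ 2 (volume : Measure ℝ)) (mn : ℤ × ℤ) :
    Lp ℂ 2 (volume : Measure ℝ) :=
  (memLp_timeFreqShift (Lp.memLp g) mn.1 mn.2).toLp (timeFreqShift g mn.1 mn.2)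

/-- `‖f‖_{L^q(k, k+1)}`, with values in `[0, ∞]`. -/
def unitIntervalNorm (q : ℝ≥0∞) (f : ℝ → ℂ) (k : ℤ) : ℝ≥0∞ :=
  eLpNorm f q (volume.restrict (Set.Ioo (k : ℝ) ((k : ℝ) + 1)))

/-- `∑_{|k| > R} ‖f‖_{L^q(k, k+1)}^p`, the sum being over integers `k`, with values in `[0, ∞]`. -/
def amalgamTail (p q : ℝ≥0∞) (R : ℝ) (f : ℝ → ℂ) : ℝ≥0∞ :=
  ∑' k : {k : ℤ // R < |(k : ℝ)|}, unitIntervalNorm q f k ^ p.toReal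

end

/-!
The Riesz bounds say that the Zak transform `G` of `g` satisfies `√A ≤ |G| ≤ √B` almost everywhere.
Being quasi-periodic, `G` winds once around the origin along the boundary of the unit square, so
without zeros it cannot be continuous: sampled on a translate of the grid `(1/K) ℤ × (1/M) ℤ`, it
makes a jump of size `≳ √A` somewhere in the unit square. Averaging over the translates, the jumps
in the two directions together have measure at least `1 / (K M)`.

In the second variable, the Fourier coefficients of `G x` are the samples `g (x + k)`. The
frequencies `|k| ≤ R` contribute little to an increment of length `≪ 1 / R`, so, by a weak-type
Hausdorff–Young inequality, the measure of the jumps at this scale is controlled by the tail of `g`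
beyond `R`. Up to a unimodular factor, exchanging the variables of `G` replaces `g` by the conjugate
of `𝓕 g`, which controls the jumps in the other direction by the tail of `𝓕 g` beyond `L`. Taking
`1 / M ≈ 1 / R` and `1 / K ≈ 1 / L` gives the estimate for `p > 1`, with a constant independent of
`p`; the case `p = 1` follows by letting `p` decrease to `1`.
-/

theorem mul_rpow_sub_one_le_rpow {x y : ℝ≥0∞} (h : y ≤ x) {p : ℝ} (hp : 1 ≤ p) :
    x * y ^ (p - 1) ≤ x ^ p :=
  calc x * y ^ (p - 1) ≤ x ^ (1 : ℝ) * x ^ (p - 1) := by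
        have := sub_nonneg.2 hp
        rw [ENNReal.rpow_one]
        gcongr
    _ = x ^ p := by
        rw [← ENNReal.rpow_add_of_nonneg _ _ zero_le_one (sub_nonneg.2 hp), add_sub_cancel]

theorem sq_le_rpow_two_sub_mul_rpow {x y : ℝ≥0∞} (h : x ≤ y) {p : ℝ} (hp : 0 ≤ p) (hp2 : p ≤ 2) :
    x ^ 2 ≤ y ^ (2 - p) * x ^ p :=
  calc x ^ 2 = x ^ (2 - p) * x ^ p := by
        rw [← ENNReal.rpow_add_of_nonneg _ _ (sub_nonneg.2 hp2) hp, sub_add_cancel,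
          ENNReal.rpow_two]
    _ ≤ y ^ (2 - p) * x ^ p := by
        have := sub_nonneg.2 hp2
        gcongr

/-- `S` consists of the indices at which `c` exceeds the level `ℓ` with
`a ℓ ^ (p - 1) = ∑ c ^ p`. -/
theorem exists_finset_sum_le_tsum_sq_le {ι : Type*} {c : ι → ℝ≥0∞} {a : ℝ≥0∞} (ha : a ≠ 0)
    (ha' : a ≠ ∞) {p : ℝ} (hp : 1 < p) (hp2 : p ≤ 2) (hc : ∑' k, c k ^ p ≠ ∞) :
    ∃ S : Finset ι, ∑ k ∈ S, c k ≤ a ∧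
      ∑' k : {k // k ∉ S}, c k ^ 2 ≤ a * (a⁻¹ * ∑' k, c k ^ p) ^ (1 / (p - 1)) := by
  have hp1 : 0 < p - 1 := sub_pos.2 hp
  set τ : ℝ≥0∞ := ∑' k, c k ^ p
  set ℓ : ℝ≥0∞ := (a⁻¹ * τ) ^ (1 / (p - 1)) with hℓ
  have hℓp : a * ℓ ^ (p - 1) = τ := by
    rw [hℓ, ← ENNReal.rpow_mul, one_div_mul_cancel hp1.ne', ENNReal.rpow_one, ← mul_assoc,
      ENNReal.mul_inv_cancel ha ha', one_mul]
  rcases eq_or_ne τ 0 with hτ | hτ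
  · have hc0 : ∀ k, c k = 0 := fun k =>
      (ENNReal.rpow_eq_zero_iff_of_pos (by linarith)).1 (ENNReal.tsum_eq_zero.1 hτ k)
    exact ⟨∅, by simp, by simp [hc0]⟩
  have hℓ0 : ℓ ≠ 0 := fun h => hτ (by rw [← hℓp, h, ENNReal.zero_rpow_of_pos hp1, mul_zero])
  have hℓ' : ℓ ≠ ∞ := ENNReal.rpow_ne_top_of_nonneg (by positivity) (by finiteness)
  have hfin : {k | ℓ < c k}.Finite :=
    (ENNReal.finite_const_le_of_tsum_ne_top hc (ENNReal.rpow_pos hℓ0.bot_lt hℓ').ne').subset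
      fun k (hk : ℓ < c k) => ENNReal.rpow_le_rpow hk.le (by linarith)
  refine ⟨hfin.toFinset, ?_, ?_⟩
  · have hlarge : ∀ k ∈ hfin.toFinset, c k * ℓ ^ (p - 1) ≤ c k ^ p := fun k hk =>
      mul_rpow_sub_one_le_rpow (hfin.mem_toFinset.1 hk).le hp.le
    refine (ENNReal.mul_le_mul_iff_left (c := ℓ ^ (p - 1)) (ENNReal.rpow_pos hℓ0.bot_lt hℓ').ne'
      (ENNReal.rpow_ne_top_of_nonneg hp1.le hℓ')).1 ?_
    rw [hℓp, Finset.sum_mul]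
    exact (Finset.sum_le_sum hlarge).trans (ENNReal.sum_le_tsum _)
  · have hsmall : ∀ k : {k // k ∉ hfin.toFinset}, c k ^ 2 ≤ ℓ ^ (2 - p) * c k ^ p := fun k =>
      sq_le_rpow_two_sub_mul_rpow (by simpa using k.2) (by linarith) hp2
    calc ∑' k : {k // k ∉ hfin.toFinset}, c k ^ 2
        ≤ ∑' k : {k // k ∉ hfin.toFinset}, ℓ ^ (2 - p) * c k ^ p := ENNReal.tsum_le_tsum hsmall
      _ ≤ ℓ ^ (2 - p) * τ := by
          rw [ENNReal.tsum_mul_left]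
          gcongr
          exact ENNReal.tsum_comp_le_tsum_of_injective Subtype.val_injective fun k => c k ^ p
      _ = a * ℓ := by
          rw [← hℓp, mul_left_comm, ← ENNReal.rpow_add_of_nonneg _ _ (by linarith) hp1.le,
            sub_add_sub_cancel, show (2 : ℝ) - 1 = 1 by norm_num, ENNReal.rpow_one]

section AddCircle

open AddCircle

theorem enorm_fourier {T : ℝ} (k : ℤ) (t : AddCircle T) : ‖fourier k t‖ₑ = 1 := by
  rw [fourier_apply, ← ofReal_norm, Circle.norm_coe, ENNReal.ofReal_one]

variable {T : ℝ} [Fact (0 < T)]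

theorem tsum_enorm_sq_fourierCoeff {f : AddCircle T → ℂ} (hf : MemLp f 2 haarAddCircle) :
    ∑' k, ‖fourierCoeff f k‖ₑ ^ 2 = ∫⁻ t, ‖f t‖ₑ ^ 2 ∂haarAddCircle := by
  have hsum := hasSum_sq_fourierCoeff hf.toLp
  rw [fourierCoeff_congr_ae hf.coeFn_toLp] at hsum
  have hint : ∫ t, ‖hf.toLp f t‖ ^ 2 ∂haarAddCircle = ∫ t, ‖f t‖ ^ 2 ∂haarAddCircle :=
    integral_congr_ae (hf.coeFn_toLp.mono fun t ht => by simp only [ht])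
  rw [hint] at hsum
  simp only [← ofReal_norm, ← ENNReal.ofReal_pow (norm_nonneg _)]
  rw [← ENNReal.ofReal_tsum_of_nonneg (fun _ => by positivity) hsum.summable, hsum.tsum_eq,
    ofReal_integral_eq_lintegral_ofReal hf.integrable_norm_pow'
      (Filter.Eventually.of_forall fun _ => by positivity)]

theorem meas_ge_le_tsum_enorm_sq_fourierCoeff {f : AddCircle T → ℂ} (hf : MemLp f 2 haarAddCircle)
    {η : ℝ≥0∞} (hη : η ≠ 0) (hη' : η ≠ ∞) :
    haarAddCircle {t | η ≤ ‖f t‖ₑ} ≤ (∑' k, ‖fourierCoeff f k‖ₑ ^ 2) / η ^ 2 := by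
  rw [tsum_enorm_sq_fourierCoeff hf]
  refine (measure_mono fun t (ht : η ≤ ‖f t‖ₑ) => ?_).trans
    (meas_ge_le_lintegral_div (hf.aestronglyMeasurable.enorm.pow_const 2) (by positivity)
      (ENNReal.pow_ne_top hη'))
  exact pow_le_pow_left₀ zero_le ht 2

theorem fourierCoeff_sub {f g : AddCircle T → ℂ} (hf : Integrable f haarAddCircle)
    (hg : Integrable g haarAddCircle) : fourierCoeff (f - g) = fourierCoeff f - fourierCoeff g := by
  have hneg : f - g = f + (-1 : ℂ) • g := by simp [sub_eq_add_neg]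
  rw [hneg, fourierCoeff.add hf (hg.smul _)]
  ext k
  rw [Pi.add_apply, fourierCoeff.const_smul, neg_one_smul, Pi.sub_apply, sub_eq_add_neg]

theorem memLp_of_continuousMap (f : C(AddCircle T, ℂ)) (p : ℝ≥0∞) : MemLp f p haarAddCircle :=
  f.continuous.memLp_of_hasCompactSupport (HasCompactSupport.of_compactSpace _)

theorem fourierCoeff_sum_smul_fourier {ι : Type*} (s : Finset ι) (c : ι → ℂ) (n : ι → ℤ) (k : ℤ) :
    fourierCoeff (∑ i ∈ s, c i • fourier (n i) : C(AddCircle T, ℂ)) k =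
      ∑ i ∈ s, if n i = k then c i else 0 := by
  rw [ContinuousMap.coe_sum, fourierCoeff.sum s _
    fun i _ => memLp_one_iff_integrable.1 (memLp_of_continuousMap _ 1), Finset.sum_apply]
  refine Finset.sum_congr rfl fun i _ => ?_
  simp [fourierCoeff.const_smul, fourierCoeff_fourier, Pi.single_apply,
    eq_comm]

theorem meas_ge_le_of_sum_enorm_fourierCoeff_le {f : AddCircle T → ℂ} (hf : MemLp f 2 haarAddCircle)
    {a : ℝ≥0∞} (ha : a ≠ 0) (ha' : a ≠ ∞) (S : Finset ℤ)
    (hS : ∑ k ∈ S, ‖fourierCoeff f k‖ₑ ≤ a) :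
    haarAddCircle {t | a + a ≤ ‖f t‖ₑ} ≤
      (∑' k : {k // k ∉ S}, ‖fourierCoeff f k‖ₑ ^ 2) / a ^ 2 := by
  set P : C(AddCircle T, ℂ) := ∑ k ∈ S, fourierCoeff f k • fourier k
  have hP : ∀ t, ‖P t‖ₑ ≤ a := fun t => by
    refine le_trans ?_ hS
    simp only [P, ContinuousMap.coe_sum, Finset.sum_apply, ContinuousMap.coe_smul, Pi.smul_apply]
    refine (enorm_sum_le _ _).trans_eq (Finset.sum_congr rfl fun k _ => ?_)
    rw [enorm_smul, enorm_fourier, mul_one]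
  have hP2 : MemLp P 2 haarAddCircle := memLp_of_continuousMap P 2
  have hcoeff : ∀ k, fourierCoeff (f - ⇑P) k = if k ∈ S then 0 else fourierCoeff f k := fun k => by
    rw [fourierCoeff_sub (hf.integrable one_le_two) (hP2.integrable one_le_two), Pi.sub_apply,
      fourierCoeff_sum_smul_fourier, Finset.sum_ite_eq']
    split_ifs <;> simp
  calc haarAddCircle {t | a + a ≤ ‖f t‖ₑ} ≤ haarAddCircle {t | a ≤ ‖(f - ⇑P) t‖ₑ} := by
        refine measure_mono fun t (ht : a + a ≤ ‖f t‖ₑ) => ?_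
        have htri : ‖f t‖ₑ ≤ ‖(f - ⇑P) t‖ₑ + a := by
          refine le_trans ?_ (add_le_add_right (hP t) _)
          simpa using enorm_add_le ((f - ⇑P) t) (P t)
        exact (ENNReal.add_le_add_iff_right ha').1 (ht.trans htri)
    _ ≤ _ := meas_ge_le_tsum_enorm_sq_fourierCoeff (hf.sub hP2) ha ha'
    _ = _ := by
        congr 1
        refine Eq.trans ?_ (tsum_subtype {k | k ∉ S} fun k => ‖fourierCoeff f k‖ₑ ^ 2).symm
        refine tsum_congr fun k => ?_
        by_cases hk : k ∈ S <;> simp [hcoeff, hk]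

/-- A weak-type substitute for the Hausdorff–Young inequality. -/
theorem meas_ge_le_tsum_enorm_rpow_fourierCoeff {f : AddCircle T → ℂ}
    (hf : MemLp f 2 haarAddCircle) {a : ℝ≥0∞} (ha : a ≠ 0) (ha' : a ≠ ∞) {p : ℝ} (hp : 1 < p)
    (hp2 : p ≤ 2) :
    haarAddCircle {t | a + a ≤ ‖f t‖ₑ} ≤
      a⁻¹ * (a⁻¹ * ∑' k, ‖fourierCoeff f k‖ₑ ^ p) ^ (1 / (p - 1)) := by
  have ha0 : a⁻¹ ≠ 0 := ENNReal.inv_ne_zero.2 ha'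
  rcases eq_or_ne (∑' k, ‖fourierCoeff f k‖ₑ ^ p) ∞ with htop | htop
  · rw [htop, ENNReal.mul_top ha0, ENNReal.top_rpow_of_pos (one_div_pos.2 (sub_pos.2 hp)),
      ENNReal.mul_top ha0]
    exact le_top
  obtain ⟨S, hS, hSc⟩ := exists_finset_sum_le_tsum_sq_le ha ha' hp hp2 htop
  refine (meas_ge_le_of_sum_enorm_fourierCoeff_le hf ha ha' S hS).trans ?_
  refine (ENNReal.div_le_div_right hSc _).trans_eq ?_
  rw [sq, ENNReal.mul_div_mul_left _ _ ha ha', ENNReal.div_eq_inv_mul]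

end AddCircle

theorem eLpNorm_two_sq_eq_lintegral {α E : Type*} [MeasurableSpace α] [ENorm E] (μ : Measure α)
    (f : α → E) : eLpNorm f 2 μ ^ 2 = ∫⁻ x, ‖f x‖ₑ ^ 2 ∂μ := by
  simpa using eLpNorm_nnreal_pow_eq_lintegral (μ := μ) (f := f) (p := 2) two_ne_zero

section ValleePoussin

open AddCircle

/-- The sum of the characters of the circle with frequencies in `S`. -/
noncomputable def characterSum (S : Finset ℤ) : C(UnitAddCircle, ℂ) :=
  ∑ k ∈ S, fourier k

/-- The de la Vallée Poussin kernel, whose Fourier coefficients are `1` at `|k| ≤ N`, lie in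
`[0, 1]`, and vanish at `|k| ≥ 2N`. Writing it as a product of two character sums gives access to
its `L¹` norms through the Cauchy–Schwarz inequality. -/
noncomputable def valleePoussinKernel (N : ℕ) : C(UnitAddCircle, ℂ) :=
  (N : ℂ)⁻¹ • (characterSum (Finset.Ioc (-N) 0) * characterSum (Finset.Ico (-N) (2 * N)))

/-- The convolution of `f` with the de la Vallée Poussin kernel. -/
noncomputable def valleePoussinMean (N : ℕ) (f : UnitAddCircle → ℂ) (t : UnitAddCircle) : ℂ :=
  ∫ u, valleePoussinKernel N (t - u) * f u ∂haarAddCircle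

theorem norm_fourier_sub_one_le (k : ℤ) (s : UnitAddCircle) :
    ‖fourier k s - 1‖ ≤ 2 * Real.pi * |(k : ℝ)| * ‖s‖ := by
  obtain ⟨r, rfl, hr⟩ : ∃ r : ℝ, (r : UnitAddCircle) = s ∧ |r| = ‖s‖ := by
    induction s using QuotientAddGroup.induction_on with | _ x =>
    refine ⟨x - round x, ?_, (UnitAddCircle.norm_eq).symm⟩
    rw [AddCircle.coe_sub, sub_eq_self]
    exact AddCircle.coe_eq_zero_iff _ |>.2 ⟨round x, by simp⟩
  have harg : (2 * Real.pi * Complex.I * k * r / (1 : ℝ) : ℂ) =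
      Complex.I * ((2 * Real.pi * k * r : ℝ) : ℂ) := by push_cast; ring
  rw [fourier_coe_apply, harg, ← hr]
  refine (Real.norm_exp_I_mul_ofReal_sub_one_le).trans_eq ?_
  rw [Real.norm_eq_abs, abs_mul, abs_mul, abs_mul, abs_two, abs_of_pos Real.pi_pos]

theorem eLpNorm_sum_smul_fourier_le {S : Finset ℤ} {c : ℤ → ℂ} {b : ℝ} (hb : 0 ≤ b)
    (hc : ∀ k ∈ S, ‖c k‖ ≤ b) :
    eLpNorm (∑ k ∈ S, c k • fourier k : C(UnitAddCircle, ℂ)) 2 haarAddCircle ≤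
      ENNReal.ofReal (b * √S.card) := by
  have hsq : ∫⁻ t, ‖(∑ k ∈ S, c k • fourier k : C(UnitAddCircle, ℂ)) t‖ₑ ^ 2 ∂haarAddCircle =
      ∑ k ∈ S, ‖c k‖ₑ ^ 2 := by
    rw [← tsum_enorm_sq_fourierCoeff (memLp_of_continuousMap _ 2)]
    simp only [fourierCoeff_sum_smul_fourier, Finset.sum_ite_eq']
    rw [tsum_eq_sum (s := S) fun k hk => by simp [hk]]
    exact Finset.sum_congr rfl fun k hk => by rw [if_pos hk]
  rw [← ENNReal.pow_le_pow_left_iff two_ne_zero, ← ENNReal.ofReal_pow (by positivity), mul_pow,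
    Real.sq_sqrt (by positivity)]
  rw [eLpNorm_two_sq_eq_lintegral, hsq, mul_comm, ← nsmul_eq_mul, ENNReal.ofReal_nsmul]
  refine Finset.sum_le_card_nsmul _ _ _ fun k hk => ?_
  rw [← ofReal_norm, ← ENNReal.ofReal_pow (norm_nonneg _)]
  exact ENNReal.ofReal_le_ofReal (pow_le_pow_left₀ (norm_nonneg _) (hc k hk) 2)

theorem eLpNorm_characterSum_le (S : Finset ℤ) :
    eLpNorm (characterSum S) 2 haarAddCircle ≤ ENNReal.ofReal √S.card := by
  simpa [characterSum] using eLpNorm_sum_smul_fourier_le (S := S) (c := 1) zero_le_one (by simp)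

theorem eLpNorm_characterSum_translate_sub_le {S : Finset ℤ} {n : ℕ} (hS : ∀ k ∈ S, |k| ≤ n)
    (s : UnitAddCircle) :
    eLpNorm (fun t => characterSum S (t + s) - characterSum S t) 2 haarAddCircle ≤
      ENNReal.ofReal (2 * Real.pi * n * ‖s‖ * √S.card) := by
  have hc : ∀ k ∈ S, ‖fourier k s - 1‖ ≤ 2 * Real.pi * n * ‖s‖ := fun k hk => by
    refine (norm_fourier_sub_one_le k s).trans ?_
    gcongr
    exact_mod_cast hS k hk
  convert eLpNorm_sum_smul_fourier_le (by positivity) hc using 2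
  ext t
  simp only [characterSum, ContinuousMap.coe_sum, Finset.sum_apply, ContinuousMap.coe_smul,
    Pi.smul_apply, smul_eq_mul, ← Finset.sum_sub_distrib]
  refine Finset.sum_congr rfl fun k _ => ?_
  simp only [fourier_apply, smul_add, AddCircle.toCircle_add, Circle.coe_mul]
  ring

theorem lintegral_mul_translate_sub_le (D E : C(UnitAddCircle, ℂ)) (s : UnitAddCircle) :
    ∫⁻ t, ‖D (t + s) * E (t + s) - D t * E t‖ₑ ∂haarAddCircle ≤
      eLpNorm (fun t => D (t + s) - D t) 2 haarAddCircle * eLpNorm E 2 haarAddCircle +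
        eLpNorm D 2 haarAddCircle * eLpNorm (fun t => E (t + s) - E t) 2 haarAddCircle := by
  have hmeas : ∀ K : C(UnitAddCircle, ℂ), AEStronglyMeasurable K haarAddCircle :=
    fun K => K.continuous.aestronglyMeasurable
  have hmeas' : ∀ K : C(UnitAddCircle, ℂ), AEStronglyMeasurable (fun t => K (t + s))
      haarAddCircle :=
    fun K => Continuous.aestronglyMeasurable (by fun_prop)
  have hsplit : (fun t => D (t + s) * E (t + s) - D t * E t) =
      (fun t => D (t + s) - D t) • (fun t => E (t + s)) +
        (D : UnitAddCircle → ℂ) • (fun t => E (t + s) - E t) := by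
    ext t
    simp only [Pi.add_apply, Pi.mul_apply, smul_eq_mul]
    ring
  have htranslate : eLpNorm (fun t => E (t + s)) 2 haarAddCircle = eLpNorm E 2 haarAddCircle :=
    eLpNorm_comp_measurePreserving (hmeas E) (measurePreserving_add_right haarAddCircle s)
  rw [← eLpNorm_one_eq_lintegral_enorm, hsplit, ← htranslate]
  refine (eLpNorm_add_le ?_ ?_ le_rfl).trans (add_le_add ?_ ?_)
  · exact ((hmeas' D).sub (hmeas D)).smul (hmeas' E)
  · exact (hmeas D).smul ((hmeas' E).sub (hmeas E))
  · exact eLpNorm_smul_le_mul_eLpNorm (p := 2) (q := 2) (hmeas' E) ((hmeas' D).sub (hmeas D))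
  · exact eLpNorm_smul_le_mul_eLpNorm (p := 2) (q := 2) ((hmeas' E).sub (hmeas E)) (hmeas D)

theorem lintegral_valleePoussinKernel_translate_sub_le {N : ℕ} (hN : N ≠ 0) (s : UnitAddCircle) :
    ∫⁻ t, ‖valleePoussinKernel N (t + s) - valleePoussinKernel N t‖ₑ ∂haarAddCircle ≤
      ENNReal.ofReal (40 * N * ‖s‖) := by
  have hD := eLpNorm_characterSum_le (Finset.Ioc (-N) 0)
  have hE := eLpNorm_characterSum_le (Finset.Ico (-N) (2 * N))
  have hDs := eLpNorm_characterSum_translate_sub_le (S := Finset.Ioc (-N : ℤ) 0) (n := N)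
    (fun k hk => by rw [abs_le]; rw [Finset.mem_Ioc] at hk; omega) s
  have hEs := eLpNorm_characterSum_translate_sub_le (S := Finset.Ico (-N : ℤ) (2 * N)) (n := 2 * N)
    (fun k hk => by rw [abs_le]; rw [Finset.mem_Ico] at hk; push_cast; omega) s
  rw [show (Finset.Ioc (-N : ℤ) 0).card = N by simp] at hD hDs
  rw [show (Finset.Ico (-N : ℤ) (2 * N)).card = 3 * N by rw [Int.card_Ico]; omega] at hE hEs
  simp only [valleePoussinKernel, ContinuousMap.coe_smul, ContinuousMap.coe_mul, Pi.smul_apply,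
    Pi.mul_apply, ← smul_sub, enorm_smul]
  rw [lintegral_const_mul' _ _ enorm_ne_top]
  calc _ ≤ ‖(N : ℂ)⁻¹‖ₑ *
        (ENNReal.ofReal (2 * Real.pi * N * ‖s‖ * √N) * ENNReal.ofReal √(3 * N : ℕ) +
          ENNReal.ofReal √N *
            ENNReal.ofReal (2 * Real.pi * (2 * N : ℕ) * ‖s‖ * √(3 * N : ℕ))) := by
        gcongr
        exact (lintegral_mul_translate_sub_le _ _ s).trans (by gcongr)
    _ = ENNReal.ofReal (6 * Real.pi * √3 * N * ‖s‖) := by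
        rw [← ENNReal.ofReal_mul (by positivity), ← ENNReal.ofReal_mul (by positivity),
          ← ENNReal.ofReal_add (by positivity) (by positivity), ← ofReal_norm,
          ← ENNReal.ofReal_mul (by positivity), norm_inv, Complex.norm_natCast]
        congr 1
        have hNs : √(N : ℝ) ^ 2 = N := Real.sq_sqrt (by positivity)
        push_cast
        rw [Real.sqrt_mul (by norm_num)]
        field_simp
        rw [hNs]
        ring
    _ ≤ ENNReal.ofReal (40 * N * ‖s‖) := by
        have hsqrt : √3 ≤ 1.8 := Real.sqrt_le_iff.2 (by norm_num)
        have hpi := Real.pi_lt_d2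
        gcongr
        nlinarith [Real.pi_pos, Real.sqrt_nonneg 3]

theorem valleePoussinKernel_eq_sum (N : ℕ) :
    valleePoussinKernel N =
      ∑ q ∈ Finset.Ioc (-N : ℤ) 0 ×ˢ Finset.Ico (-N : ℤ) (2 * N),
        (N : ℂ)⁻¹ • fourier (q.1 + q.2) := by
  ext t
  simp only [valleePoussinKernel, characterSum, Finset.sum_mul_sum, ← Finset.sum_product',
    Finset.smul_sum, ContinuousMap.coe_sum, ContinuousMap.coe_smul, ContinuousMap.coe_mul,
    fourier_add, Finset.sum_apply, Pi.smul_apply, Pi.mul_apply]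

theorem fourierCoeff_valleePoussinKernel (N : ℕ) (k : ℤ) :
    fourierCoeff (valleePoussinKernel N) k =
      (N : ℂ)⁻¹ * ((Finset.Ioc (-N : ℤ) 0).filter
        fun j => k - j ∈ Finset.Ico (-N : ℤ) (2 * N)).card := by
  rw [valleePoussinKernel_eq_sum, fourierCoeff_sum_smul_fourier, Finset.sum_product,
    Finset.card_filter, Nat.cast_sum, Finset.mul_sum]
  refine Finset.sum_congr rfl fun j _ => ?_
  simp only [← eq_sub_iff_add_eq', Finset.sum_ite_eq', Nat.cast_ite, Nat.cast_one, Nat.cast_zero,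
    mul_ite, mul_one, mul_zero]

theorem enorm_one_sub_fourierCoeff_valleePoussinKernel_le {N : ℕ} (hN : N ≠ 0) (k : ℤ) :
    ‖1 - fourierCoeff (valleePoussinKernel N) k‖ₑ ≤ if (N : ℤ) < |k| then 1 else 0 := by
  have hN' : (0 : ℝ) < N := by positivity
  set F := (Finset.Ioc (-N : ℤ) 0).filter fun j => k - j ∈ Finset.Ico (-N : ℤ) (2 * N) with hF
  have hreal : 1 - fourierCoeff (valleePoussinKernel N) k = ((1 - F.card / N : ℝ) : ℂ) := by
    rw [fourierCoeff_valleePoussinKernel]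
    push_cast
    ring
  rw [hreal]
  split_ifs with hk
  · have hcard : F.card ≤ N := (Finset.card_filter_le _ _).trans_eq (by simp)
    have hcard' : (F.card : ℝ) / N ≤ 1 := (div_le_one hN').2 (mod_cast hcard)
    rw [← ofReal_norm, Complex.norm_real, Real.norm_of_nonneg (sub_nonneg.2 hcard')]
    exact ENNReal.ofReal_le_one.2 (sub_le_self _ (by positivity))
  · have hcard : F.card = N := by
      rw [hF, Finset.filter_true_of_mem, Int.card_Ioc, sub_neg_eq_add, zero_add, Int.toNat_natCast]
      intro j hj
      rw [not_lt, abs_le] at hk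
      rw [Finset.mem_Ioc] at hj
      rw [Finset.mem_Ico]
      omega
    simp [hcard, hN]

theorem integral_sum_smul_fourier_mul {ι : Type*} {f : UnitAddCircle → ℂ}
    (hf : Integrable f haarAddCircle) (S : Finset ι) (c : ι → ℂ) (n : ι → ℤ) (t : UnitAddCircle) :
    ∫ u, (∑ i ∈ S, c i • fourier (n i) : C(UnitAddCircle, ℂ)) (t - u) * f u ∂haarAddCircle =
      (∑ i ∈ S, (c i * fourierCoeff f (n i)) • fourier (n i) : C(UnitAddCircle, ℂ)) t := by
  have hterm : ∀ i u, c i • fourier (n i) (t - u) * f u =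
      (c i * fourier (n i) t) * (fourier (-n i) u • f u) := fun i u => by
    simp only [fourier_apply, sub_eq_add_neg, smul_add, neg_smul, smul_neg,
      AddCircle.toCircle_add, Circle.coe_mul, smul_eq_mul]
    ring
  simp only [ContinuousMap.coe_sum, ContinuousMap.coe_smul, Finset.sum_apply, Pi.smul_apply,
    Finset.sum_mul, hterm]
  rw [integral_finsetSum _ fun i _ => ?_]
  · refine Finset.sum_congr rfl fun i _ => ?_
    rw [integral_const_mul, fourierCoeff, smul_eq_mul]
    ring
  · exact (hf.fourier_smul (n := -n i)).const_mul _

theorem valleePoussinMean_eq_sum {f : UnitAddCircle → ℂ} (hf : Integrable f haarAddCircle) (N : ℕ) :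
    valleePoussinMean N f =
      (∑ q ∈ Finset.Ioc (-N : ℤ) 0 ×ˢ Finset.Ico (-N : ℤ) (2 * N),
        ((N : ℂ)⁻¹ * fourierCoeff f (q.1 + q.2)) • fourier (q.1 + q.2) : C(UnitAddCircle, ℂ)) := by
  ext t
  rw [valleePoussinMean, valleePoussinKernel_eq_sum, integral_sum_smul_fourier_mul hf]

theorem fourierCoeff_valleePoussinMean {f : UnitAddCircle → ℂ} (hf : Integrable f haarAddCircle)
    (N : ℕ) (k : ℤ) :
    fourierCoeff (valleePoussinMean N f) k =
      fourierCoeff (valleePoussinKernel N) k * fourierCoeff f k := by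
  rw [valleePoussinMean_eq_sum hf, valleePoussinKernel_eq_sum, fourierCoeff_sum_smul_fourier,
    fourierCoeff_sum_smul_fourier, Finset.sum_mul]
  refine Finset.sum_congr rfl fun q _ => ?_
  split_ifs with hq
  · rw [hq]
  · rw [zero_mul]

theorem memLp_valleePoussinMean {f : UnitAddCircle → ℂ} (hf : Integrable f haarAddCircle) (N : ℕ)
    (p : ℝ≥0∞) : MemLp (valleePoussinMean N f) p haarAddCircle := by
  rw [valleePoussinMean_eq_sum hf]
  exact memLp_of_continuousMap _ p

theorem tsum_enorm_fourierCoeff_sub_valleePoussinMean_rpow_le {f : UnitAddCircle → ℂ}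
    (hf : Integrable f haarAddCircle) {N : ℕ} (hN : N ≠ 0) {p : ℝ} (hp : 0 < p) :
    ∑' k, ‖fourierCoeff (f - valleePoussinMean N f) k‖ₑ ^ p ≤
      ∑' k : {k : ℤ // (N : ℤ) < |k|}, ‖fourierCoeff f k‖ₑ ^ p := by
  refine le_of_le_of_eq (ENNReal.tsum_le_tsum fun k => ?_)
    (tsum_subtype {k : ℤ | (N : ℤ) < |k|} fun k => ‖fourierCoeff f k‖ₑ ^ p).symm
  have hk := enorm_one_sub_fourierCoeff_valleePoussinKernel_le hN k
  rw [fourierCoeff_sub hf ((memLp_valleePoussinMean hf N 1).integrable le_rfl), Pi.sub_apply,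
    fourierCoeff_valleePoussinMean hf, ← one_sub_mul, enorm_mul]
  by_cases hkN : (N : ℤ) < |k|
  · rw [if_pos hkN] at hk
    rw [Set.indicator_of_mem (by exact hkN)]
    gcongr
    exact mul_le_of_le_one_left' hk
  · rw [if_neg hkN, nonpos_iff_eq_zero] at hk
    simp [hk, hp]

theorem norm_valleePoussinMean_translate_sub_le {f : UnitAddCircle → ℂ} {β : ℝ}
    (hf : Integrable f haarAddCircle) (hβ : ∀ᵐ t ∂haarAddCircle, ‖f t‖ ≤ β) {N : ℕ}
    (hN : N ≠ 0) (s t : UnitAddCircle) :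
    ‖valleePoussinMean N f (t + s) - valleePoussinMean N f t‖ ≤ 40 * N * ‖s‖ * β := by
  have hβ0 : 0 ≤ β := (hβ.exists.choose_spec).trans' (norm_nonneg _)
  have hint : ∀ t, Integrable (fun u => valleePoussinKernel N (t - u) * f u) haarAddCircle := by
    intro t
    obtain ⟨C, hC⟩ := (isCompact_range (valleePoussinKernel N).continuous).isBounded.exists_norm_le
    exact hf.bdd_mul (c := C)
      ((valleePoussinKernel N).continuous.comp (continuous_sub_left t)).aestronglyMeasurable
      (Filter.Eventually.of_forall fun u => hC _ ⟨_, rfl⟩)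
  rw [← ENNReal.ofReal_le_ofReal_iff (by positivity), ofReal_norm, valleePoussinMean,
    valleePoussinMean, ← integral_sub (hint _) (hint t), ENNReal.ofReal_mul (by positivity)]
  calc _ ≤ ∫⁻ u, ‖valleePoussinKernel N (t + s - u) * f u - valleePoussinKernel N (t - u) * f u‖ₑ
        ∂haarAddCircle := enorm_integral_le_lintegral_enorm _
    _ ≤ ∫⁻ u, ‖valleePoussinKernel N (t - u + s) - valleePoussinKernel N (t - u)‖ₑ *
        ENNReal.ofReal β ∂haarAddCircle := lintegral_mono_ae <| hβ.mono fun u hu => by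
          rw [← sub_mul, enorm_mul, sub_add_eq_add_sub, ← ofReal_norm (f u)]
          gcongr
    _ = (∫⁻ u, ‖valleePoussinKernel N (u + s) - valleePoussinKernel N u‖ₑ ∂haarAddCircle) *
        ENNReal.ofReal β := by
        rw [lintegral_mul_const' _ _ ENNReal.ofReal_ne_top, lintegral_sub_left_eq_self (fun u =>
          ‖valleePoussinKernel N (u + s) - valleePoussinKernel N u‖ₑ)]
    _ ≤ _ := by
        gcongr
        exact lintegral_valleePoussinKernel_translate_sub_le hN s

theorem translate_sub_ge_subset {G E : Type*} [Add G] [SeminormedAddCommGroup E] {f m : G → E}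
    {δ : ℝ} {s : G} (hm : ∀ t, ‖m (t + s) - m t‖ ≤ δ / 2) :
    {t | δ ≤ ‖f (t + s) - f t‖} ⊆
      (· + s) ⁻¹' {t | δ / 4 ≤ ‖(f - m) t‖} ∪ {t | δ / 4 ≤ ‖(f - m) t‖} := by
  intro t (ht : δ ≤ ‖f (t + s) - f t‖)
  by_contra! hlt
  obtain ⟨h1, h2⟩ : ‖(f - m) (t + s)‖ < δ / 4 ∧ ‖(f - m) t‖ < δ / 4 := by
    simpa only [Set.mem_union, Set.mem_preimage, Set.mem_ofPred_eq, not_or, not_le] using hlt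
  have hsplit : f (t + s) - f t = (f - m) (t + s) - (f - m) t + (m (t + s) - m t) := by
    simp only [Pi.sub_apply]
    abel
  rw [hsplit] at ht
  linarith [norm_add_le ((f - m) (t + s) - (f - m) t) (m (t + s) - m t),
    norm_sub_le ((f - m) (t + s)) ((f - m) t), hm t]

theorem meas_translate_sub_ge_le {f : UnitAddCircle → ℂ} {β δ : ℝ}
    (hf : AEStronglyMeasurable f haarAddCircle) (hβ : ∀ᵐ t ∂haarAddCircle, ‖f t‖ ≤ β) (hδ : 0 < δ)
    {N : ℕ} (hN : N ≠ 0) {s : UnitAddCircle} (hs : 80 * β * N * ‖s‖ ≤ δ) {p : ℝ} (hp : 1 < p)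
    (hp2 : p ≤ 2) :
    haarAddCircle {t | δ ≤ ‖f (t + s) - f t‖} ≤
      ENNReal.ofReal (16 / δ) * (ENNReal.ofReal (8 / δ) *
        ∑' k : {k : ℤ // (N : ℤ) < |k|}, ‖fourierCoeff f k‖ₑ ^ p) ^ (1 / (p - 1)) := by
  have hf2 : MemLp f 2 haarAddCircle := MemLp.of_bound hf β hβ
  have hf1 : Integrable f haarAddCircle := hf2.integrable one_le_two
  set h := f - valleePoussinMean N f
  have hh2 : MemLp h 2 haarAddCircle := hf2.sub (memLp_valleePoussinMean hf1 N 2)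
  have hset : {t | δ / 4 ≤ ‖h t‖} =
      {t | ENNReal.ofReal (δ / 8) + ENNReal.ofReal (δ / 8) ≤ ‖h t‖ₑ} := by
    ext t
    rw [Set.mem_ofPred_eq, Set.mem_ofPred_eq, ← ENNReal.ofReal_add (by positivity) (by positivity),
      ← ofReal_norm, ENNReal.ofReal_le_ofReal_iff (norm_nonneg _)]
    ring_nf
  have hinv : (ENNReal.ofReal (δ / 8))⁻¹ = ENNReal.ofReal (8 / δ) := by
    rw [← ENNReal.ofReal_inv_of_pos (by positivity), inv_div]
  have htail := tsum_enorm_fourierCoeff_sub_valleePoussinMean_rpow_le hf1 hN (zero_lt_one.trans hp)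
  calc _ ≤ haarAddCircle ((· + s) ⁻¹' {t | δ / 4 ≤ ‖h t‖}) + haarAddCircle {t | δ / 4 ≤ ‖h t‖} := by
        refine (measure_mono (translate_sub_ge_subset fun t => ?_)).trans (measure_union_le _ _)
        exact (norm_valleePoussinMean_translate_sub_le hf1 hβ hN s t).trans (by linarith)
    _ = 2 * haarAddCircle {t | δ / 4 ≤ ‖h t‖} := by rw [measure_preimage_add_right, two_mul]
    _ ≤ 2 * (ENNReal.ofReal (8 / δ) *
        (ENNReal.ofReal (8 / δ) * ∑' k, ‖fourierCoeff h k‖ₑ ^ p) ^ (1 / (p - 1))) := by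
        rw [hset, ← hinv]
        gcongr
        exact meas_ge_le_tsum_enorm_rpow_fourierCoeff hh2
          (by rw [ne_eq, ENNReal.ofReal_eq_zero]; linarith) ENNReal.ofReal_ne_top hp hp2
    _ ≤ _ := by
        rw [← mul_assoc, ← ENNReal.ofReal_ofNat 2, ← ENNReal.ofReal_mul (by positivity),
          ← mul_div_assoc, show (2 : ℝ) * 8 = 16 by norm_num]
        gcongr

end ValleePoussin

theorem fourierChar_intCast (k : ℤ) : 𝐞 (k : ℝ) = 1 := by
  rw [← Circle.coe_eq_one, Real.fourierChar_apply, Complex.exp_eq_one_iff]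
  exact ⟨k, by push_cast; ring⟩

section UnitInterval

/-- Lebesgue measure on the unit interval, the reference measure for functions of period one. -/
noncomputable abbrev unitMeasure : Measure ℝ := volume.restrict (Set.Ioc 0 1)

/-- Lebesgue measure on the unit square, a fundamental domain for Zak transforms. -/
noncomputable abbrev squareMeasure : Measure (ℝ × ℝ) := unitMeasure.prod unitMeasure

instance : IsProbabilityMeasure unitMeasure := ⟨by simp⟩

theorem lintegral_unitMeasure_coe (F : UnitAddCircle → ℝ≥0∞) :
    ∫⁻ y, F y ∂unitMeasure = ∫⁻ t, F t ∂AddCircle.haarAddCircle := by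
  simpa [AddCircle.volume_eq_smul_haarAddCircle] using UnitAddCircle.lintegral_preimage 0 F

theorem integral_unitMeasure_coe (F : UnitAddCircle → ℂ) :
    ∫ y, F y ∂unitMeasure = ∫ t, F t ∂AddCircle.haarAddCircle := by
  simpa [AddCircle.volume_eq_smul_haarAddCircle] using UnitAddCircle.integral_preimage 0 F

theorem measurePreserving_coe_unitMeasure :
    MeasurePreserving ((↑) : ℝ → UnitAddCircle) unitMeasure AddCircle.haarAddCircle := by
  simpa [AddCircle.volume_eq_smul_haarAddCircle] using UnitAddCircle.measurePreserving_mk 0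

theorem liftIoc_coe_of_mem {f : ℝ → ℂ} {y : ℝ} (hy : y ∈ Set.Ioc (0 : ℝ) 1) :
    AddCircle.liftIoc 1 0 f (y : UnitAddCircle) = f y :=
  AddCircle.liftIoc_coe_apply (by simpa using hy)

theorem liftIoc_coe_of_periodic {f : ℝ → ℂ} (hf : Function.Periodic f 1) (y : ℝ) :
    AddCircle.liftIoc 1 0 f (y : UnitAddCircle) = f y := by
  conv_rhs => rw [← hf.lift_coe, ← (AddCircle.equivIoc 1 0).symm_apply_apply (y : UnitAddCircle)]
  rfl

theorem memLp_liftIoc {f : ℝ → ℂ} {p : ℝ≥0∞} (hf : MemLp f p unitMeasure) :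
    MemLp (AddCircle.liftIoc 1 0 f) p AddCircle.haarAddCircle := by
  have h := MemLp.memLp_liftIoc (T := 1) (t := 0) (f := f) (p := p) (by simpa using hf)
  simpa [AddCircle.volume_eq_smul_haarAddCircle] using h

theorem fourierCoeff_liftIoc (f : ℝ → ℂ) (k : ℤ) :
    fourierCoeff (AddCircle.liftIoc 1 0 f : UnitAddCircle → ℂ) k =
      ∫ y, 𝐞 (-k * y) * f y ∂unitMeasure := by
  rw [fourierCoeff, ← integral_unitMeasure_coe]
  refine setIntegral_congr_fun measurableSet_Ioc fun y hy => ?_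
  simp only [liftIoc_coe_of_mem hy, fourier_coe_apply, Real.fourierChar_apply, smul_eq_mul]
  congr 2
  push_cast
  ring

theorem tsum_enorm_sq_integral_fourierChar_mul {f : ℝ → ℂ} (hf : MemLp f 2 unitMeasure) :
    ∑' k : ℤ, ‖∫ y, 𝐞 (k * y) * f y ∂unitMeasure‖ₑ ^ 2 = ∫⁻ y, ‖f y‖ₑ ^ 2 ∂unitMeasure := by
  rw [← (Equiv.neg ℤ).tsum_eq]
  simp only [Equiv.neg_apply, Int.cast_neg, ← fourierCoeff_liftIoc]
  rw [tsum_enorm_sq_fourierCoeff (memLp_liftIoc hf), ← lintegral_unitMeasure_coe]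
  exact setLIntegral_congr_fun measurableSet_Ioc fun y hy => by rw [liftIoc_coe_of_mem hy]

theorem lintegral_eq_tsum_lintegral_unitMeasure (f : ℝ → ℝ≥0∞) :
    ∫⁻ x, f x = ∑' k : ℤ, ∫⁻ x, f (x + k) ∂unitMeasure := by
  rw [← setLIntegral_univ, ← iUnion_Ioc_intCast ℝ,
    lintegral_iUnion (fun _ => measurableSet_Ioc) (Set.pairwise_disjoint_Ioc_intCast ℝ)]
  refine tsum_congr fun k => ?_
  rw [(measurePreserving_add_right volume (k : ℝ)).setLIntegral_comp_emb
    (measurableEmbedding_addRight _) f (Set.Ioc 0 1)]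
  simp [add_comm]

theorem hasSum_integral_unitMeasure {E : Type*} [NormedAddCommGroup E] [NormedSpace ℝ E]
    {f : ℝ → E} (hf : Integrable f) :
    HasSum (fun k : ℤ => ∫ x, f (x + k) ∂unitMeasure) (∫ x, f x) := by
  have hsum := hasSum_integral_iUnion (μ := volume) (f := f) (fun k : ℤ => measurableSet_Ioc)
    (Set.pairwise_disjoint_Ioc_intCast ℝ) hf.integrableOn
  rw [iUnion_Ioc_intCast, setIntegral_univ] at hsum
  have hshift (k : ℤ) : ∫ x, f (x + k) ∂unitMeasure = ∫ x in Set.Ioc (k : ℝ) (k + 1), f x := by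
    rw [← (measurePreserving_add_right volume (k : ℝ)).setIntegral_preimage_emb
      (measurableEmbedding_addRight _) f (Set.Ioc (k : ℝ) (k + 1))]
    simp
  simpa only [hshift] using hsum

theorem ae_iff_forall_ae_unitMeasure_add {P : ℝ → Prop} :
    (∀ᵐ x, P x) ↔ ∀ k : ℤ, ∀ᵐ x ∂unitMeasure, P (x + k) := by
  refine ⟨fun h k => ae_restrict_of_ae
    ((measurePreserving_add_right volume (k : ℝ)).quasiMeasurePreserving.ae h), fun h => ?_⟩
  rw [← Measure.restrict_univ (μ := volume), ← iUnion_Ioc_intCast ℝ, ae_restrict_iUnion_iff]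
  intro k
  have hmap := ((measurePreserving_add_right volume (k : ℝ)).restrict_preimage_emb
    (measurableEmbedding_addRight _) (Set.Ioc (k : ℝ) (k + 1))).map_eq
  rw [← hmap, (measurableEmbedding_addRight _).ae_map_iff]
  simpa using h k

end UnitInterval

section Zak

theorem apply_add_intCast_left {G : ℝ → ℝ → ℂ} (hG : ∀ x y, G (x + 1) y = 𝐞 y * G x y)
    (x y : ℝ) (k : ℤ) :
    G (x + k) y = 𝐞 (k * y) * G x y := by
  induction k using Int.induction_on with
  | zero => simp
  | succ n ih =>
    have hx : x + ((n + 1 : ℤ) : ℝ) = (x + (n : ℤ)) + 1 := by push_cast; ring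
    rw [hx, hG, ih, ← mul_assoc, ← Circle.coe_mul, ← AddChar.map_add_eq_mul]
    push_cast
    ring_nf
  | pred n ih =>
    have hx : x + ((-n : ℤ) : ℝ) = (x + (-n - 1 : ℤ)) + 1 := by push_cast; ring
    have he : 𝐞 ((-n : ℤ) * y) = 𝐞 y * 𝐞 ((-n - 1 : ℤ) * y) := by
      rw [← AddChar.map_add_eq_mul]
      push_cast
      ring_nf
    rw [hx, hG, he, Circle.coe_mul, mul_assoc] at ih
    exact mul_left_cancel₀ (Circle.coe_ne_zero _) ih

/-- The image of `L²(ℝ)` under the Zak transform `g ↦ ∑ₖ e^{-2πiky} g(x + k)`. -/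
structure IsQuasiPeriodic (G : ℝ → ℝ → ℂ) : Prop where
  measurable : Measurable (Function.uncurry G)
  add_one_left : ∀ x y, G (x + 1) y = 𝐞 y * G x y
  add_one_right : ∀ x y, G x (y + 1) = G x y
  memLp : MemLp (Function.uncurry G) 2 squareMeasure

/-- The inverse Zak transform. -/
noncomputable def zakInv (G : ℝ → ℝ → ℂ) (x : ℝ) : ℂ := ∫ y, G x y ∂unitMeasure

/-- If `g` has Zak transform `G`, then `conj ∘ ĝ` has Zak transform `zakDual G`. -/
noncomputable def zakDual (G : ℝ → ℝ → ℂ) (y x : ℝ) : ℂ := 𝐞 (x * y) * starRingEnd ℂ (G x y)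

theorem norm_zakDual (G : ℝ → ℝ → ℂ) (y x : ℝ) : ‖zakDual G y x‖ = ‖G x y‖ := by
  rw [zakDual, norm_mul, Circle.norm_coe, one_mul, RCLike.norm_conj]

namespace IsQuasiPeriodic

variable {G G' : ℝ → ℝ → ℂ}

theorem measurable_right (hG : IsQuasiPeriodic G) (x : ℝ) : Measurable (G x) :=
  hG.measurable.comp measurable_prodMk_left

theorem add_intCast_left (hG : IsQuasiPeriodic G) (x y : ℝ) (k : ℤ) :
    G (x + k) y = 𝐞 (k * y) * G x y :=
  apply_add_intCast_left hG.add_one_left x y k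

theorem zakInv_add_intCast (hG : IsQuasiPeriodic G) (x : ℝ) (k : ℤ) :
    zakInv G (x + k) = ∫ y, 𝐞 (k * y) * G x y ∂unitMeasure := by
  simp only [zakInv, hG.add_intCast_left]

theorem measurable_zakInv (hG : IsQuasiPeriodic G) : Measurable (zakInv G) :=
  (hG.measurable.stronglyMeasurable.integral_prod_right' (ν := unitMeasure)).measurable

theorem ae_memLp (hG : IsQuasiPeriodic G) : ∀ᵐ x ∂unitMeasure, MemLp (G x) 2 unitMeasure :=
  ((hG.memLp.integrable_norm_pow two_ne_zero).prod_right_ae).mono fun x hx =>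
    (memLp_two_iff_integrable_sq_norm (hG.measurable_right x).aestronglyMeasurable).2 hx

theorem eLpNorm_zakInv (hG : IsQuasiPeriodic G) :
    eLpNorm (zakInv G) 2 volume = eLpNorm (Function.uncurry G) 2 squareMeasure := by
  refine (ENNReal.pow_right_strictMono two_ne_zero).injective ?_
  simp only [eLpNorm_two_sq_eq_lintegral]
  rw [lintegral_eq_tsum_lintegral_unitMeasure, ← lintegral_tsum, lintegral_prod]
  · refine lintegral_congr_ae (hG.ae_memLp.mono fun x hx => ?_)
    simp only [hG.zakInv_add_intCast, Function.uncurry_apply_pair,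
      tsum_enorm_sq_integral_fourierChar_mul hx]
  · exact (hG.measurable.enorm.pow_const 2).aemeasurable
  · exact fun k =>
      ((hG.measurable_zakInv.comp (measurable_id.add_const _)).enorm.pow_const 2).aemeasurable

theorem memLp_zakInv (hG : IsQuasiPeriodic G) : MemLp (zakInv G) 2 volume :=
  ⟨hG.measurable_zakInv.aestronglyMeasurable, hG.eLpNorm_zakInv ▸ hG.memLp.2⟩

theorem sub (hG : IsQuasiPeriodic G) (hG' : IsQuasiPeriodic G') : IsQuasiPeriodic (G - G') where
  measurable := hG.measurable.sub hG'.measurable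
  add_one_left x y := by
    simp only [Pi.sub_apply, hG.add_one_left, hG'.add_one_left, mul_sub]
  add_one_right x y := by simp only [Pi.sub_apply, hG.add_one_right, hG'.add_one_right]
  memLp := hG.memLp.sub hG'.memLp

theorem ae_integrable (hG : IsQuasiPeriodic G) : ∀ᵐ x, Integrable (G x) unitMeasure := by
  refine ae_iff_forall_ae_unitMeasure_add.2 fun k => hG.ae_memLp.mono fun x hx => ?_
  have hk : G (x + k) = fun y => 𝐞 (k * y) * G x y := funext fun y => hG.add_intCast_left x y k
  rw [hk]
  exact (hx.integrable one_le_two).bdd_mul (c := 1) (by fun_prop)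
    (Filter.Eventually.of_forall fun y => (Circle.norm_coe _).le)

theorem zakInv_sub (hG : IsQuasiPeriodic G) (hG' : IsQuasiPeriodic G') :
    zakInv (G - G') =ᵐ[volume] zakInv G - zakInv G' := by
  filter_upwards [hG.ae_integrable, hG'.ae_integrable] with x hx hx'
  exact integral_sub hx hx'

theorem eLpNorm_zakInv_sub (hG : IsQuasiPeriodic G) (hG' : IsQuasiPeriodic G') :
    eLpNorm (zakInv G - zakInv G') 2 volume =
      eLpNorm (Function.uncurry G - Function.uncurry G') 2 squareMeasure := by
  rw [← eLpNorm_congr_ae (hG.zakInv_sub hG'), (hG.sub hG').eLpNorm_zakInv]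
  rfl

protected theorem zakDual (hG : IsQuasiPeriodic G) : IsQuasiPeriodic (zakDual G) := by
  have hmeas : Measurable (Function.uncurry (zakDual G)) := by
    refine Measurable.mul (by fun_prop) (Complex.continuous_conj.measurable.comp ?_)
    exact hG.measurable.comp measurable_swap
  refine ⟨hmeas, fun y x => ?_, fun y x => ?_, ?_⟩
  · rw [zakDual, zakDual, hG.add_one_right, mul_add, mul_one, AddChar.map_add_eq_mul,
      Circle.coe_mul]
    ring
  · rw [zakDual, zakDual, hG.add_one_left, map_mul (starRingEnd ℂ), ← Circle.coe_inv_eq_conj,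
      Circle.coe_inv, add_mul, one_mul, AddChar.map_add_eq_mul, Circle.coe_mul, ← mul_assoc,
      mul_inv_cancel_right₀ (Circle.coe_ne_zero _)]
  · exact (hG.memLp.comp_measurePreserving Measure.measurePreserving_swap).of_le
      hmeas.aestronglyMeasurable (Filter.Eventually.of_forall fun z => (norm_zakDual G _ _).le)

theorem eLpNorm_zakInv_zakDual_sub (hG : IsQuasiPeriodic G) (hG' : IsQuasiPeriodic G') :
    eLpNorm (zakInv (zakDual G) - zakInv (zakDual G')) 2 volume =
      eLpNorm (Function.uncurry G - Function.uncurry G') 2 squareMeasure := by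
  rw [hG.zakDual.eLpNorm_zakInv_sub hG'.zakDual, ← eLpNorm_comp_measurePreserving
    (hG.measurable.sub hG'.measurable).aestronglyMeasurable Measure.measurePreserving_swap]
  refine eLpNorm_congr_norm_ae (Filter.Eventually.of_forall fun z => ?_)
  simp only [Function.uncurry, zakDual, Pi.sub_apply, Function.comp, Prod.swap]
  rw [← mul_sub, norm_mul, Circle.norm_coe, one_mul, ← map_sub, RCLike.norm_conj]

end IsQuasiPeriodic

end Zak

section QuasiPeriodicExtension

/-- The quasi-periodic extension of a function on the unit square. -/
noncomputable def quasiPeriodicExt (F : ℝ × ℝ → ℂ) (x y : ℝ) : ℂ :=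
  𝐞 (⌊x⌋ * y) * F (Int.fract x, Int.fract y)

theorem quasiPeriodicExt_ae_eq (F : ℝ × ℝ → ℂ) :
    Function.uncurry (quasiPeriodicExt F) =ᵐ[squareMeasure] F := by
  have hunit : ∀ᵐ x ∂unitMeasure, x ∈ Set.Ico (0 : ℝ) 1 := by
    rw [unitMeasure, ← restrict_Ico_eq_restrict_Ioc]
    exact ae_restrict_mem measurableSet_Ico
  filter_upwards [Measure.quasiMeasurePreserving_fst.ae hunit,
    Measure.quasiMeasurePreserving_snd.ae hunit] with z hz₁ hz₂
  rw [Function.uncurry, quasiPeriodicExt, Int.fract_eq_self.2 hz₁, Int.fract_eq_self.2 hz₂,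
    Int.floor_eq_zero_iff.2 hz₁]
  simp

theorem isQuasiPeriodic_quasiPeriodicExt {F : ℝ × ℝ → ℂ} (hF : Measurable F)
    (hL : MemLp F 2 squareMeasure) : IsQuasiPeriodic (quasiPeriodicExt F) where
  measurable := by
    refine Measurable.mul ?_ (hF.comp (by fun_prop))
    have hfloor : Measurable fun z : ℝ × ℝ => (⌊z.1⌋ : ℝ) := by fun_prop
    fun_prop
  add_one_left x y := by
    simp only [quasiPeriodicExt, Int.floor_add_one, Int.fract_add_one]
    rw [Int.cast_add, Int.cast_one, add_mul, one_mul, AddChar.map_add_eq_mul, Circle.coe_mul]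
    ring
  add_one_right x y := by
    simp only [quasiPeriodicExt, Int.fract_add_one]
    rw [mul_add, mul_one, AddChar.map_add_eq_mul, fourierChar_intCast, mul_one]
  memLp := hL.ae_eq (quasiPeriodicExt_ae_eq F).symm

theorem IsQuasiPeriodic.exists_tendsto {G : ℕ → ℝ → ℝ → ℂ} (hG : ∀ n, IsQuasiPeriodic (G n))
    (hcauchy : CauchySeq fun n => (hG n).memLp_zakInv.toLp (zakInv (G n))) :
    ∃ H, IsQuasiPeriodic H ∧ Filter.Tendsto
      (fun n => eLpNorm (Function.uncurry (G n) - Function.uncurry H) 2 squareMeasure)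
      Filter.atTop (nhds 0) := by
  have hcauchy' : CauchySeq fun n => (hG n).memLp.toLp (Function.uncurry (G n)) := by
    rw [EMetric.cauchySeq_iff] at hcauchy ⊢
    simpa only [Lp.edist_toLp_toLp, (hG _).eLpNorm_zakInv_sub (hG _)] using hcauchy
  obtain ⟨u, hu⟩ := cauchySeq_tendsto_of_complete hcauchy'
  refine ⟨quasiPeriodicExt u, isQuasiPeriodic_quasiPeriodicExt (Lp.stronglyMeasurable u).measurable
    (Lp.memLp u), ?_⟩
  rw [Lp.tendsto_Lp_iff_tendsto_eLpNorm'] at hu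
  refine hu.congr fun n => eLpNorm_congr_ae ?_
  exact (hG n).memLp.coeFn_toLp.sub (quasiPeriodicExt_ae_eq u).symm

end QuasiPeriodicExtension

section ZakTransform

variable {c : ℝ → ℂ}

/-- The Zak transform. It is only used for functions of compact support, for which the sum is
finite. -/
noncomputable def zak (c : ℝ → ℂ) (x y : ℝ) : ℂ := ∑' k : ℤ, 𝐞 (-k * y) * c (x + k)

theorem finite_support_add_intCast (hc : HasCompactSupport c) (x : ℝ) :
    (Function.support fun k : ℤ => c (x + k)).Finite :=
  (((Homeomorph.addLeft x).isClosedEmbedding.comp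
    Int.isClosedEmbedding_coe_real).isCompact_preimage hc.isCompact).finite_of_discrete.subset
      fun _ hk => subset_tsupport c hk

theorem summable_zak (hc : HasCompactSupport c) (x y : ℝ) :
    Summable fun k : ℤ => 𝐞 (-k * y) * c (x + k) :=
  summable_of_hasFiniteSupport <| (finite_support_add_intCast hc x).subset
    fun _ hk => right_ne_zero_of_mul hk

theorem zak_add_one_left (c : ℝ → ℂ) (x y : ℝ) : zak c (x + 1) y = 𝐞 y * zak c x y := by
  rw [zak, zak, ← tsum_mul_left, ← (Equiv.addRight (1 : ℤ)).tsum_eq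
    fun k : ℤ => 𝐞 y * (𝐞 (-k * y) * c (x + k))]
  refine tsum_congr fun k => ?_
  rw [← mul_assoc, ← Circle.coe_mul, ← AddChar.map_add_eq_mul, Equiv.coe_addRight]
  push_cast
  ring_nf

theorem zak_add_one_right (c : ℝ → ℂ) (x y : ℝ) : zak c x (y + 1) = zak c x y := by
  refine tsum_congr fun k => ?_
  rw [mul_add, mul_one, AddChar.map_add_eq_mul, ← Int.cast_neg, fourierChar_intCast, mul_one]

theorem measurable_zak (hc : HasCompactSupport c) (hcm : Measurable c) :
    Measurable (Function.uncurry (zak c)) := by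
  refine measurable_of_tendsto_metrizable' (f := fun (s : Finset ℤ) (z : ℝ × ℝ) =>
    ∑ k ∈ s, 𝐞 (-k * z.2) * c (z.1 + k)) Filter.atTop (fun s => ?_)
    (tendsto_pi_nhds.2 fun z => (summable_zak hc z.1 z.2).hasSum)
  fun_prop

theorem integral_fourierChar_intCast_mul (k : ℤ) :
    ∫ y, (𝐞 (k * y) : ℂ) ∂unitMeasure = if k = 0 then 1 else 0 := by
  have hcoe : ∀ y : ℝ, (𝐞 (k * y) : ℂ) = fourier k (y : UnitAddCircle) := fun y => by
    rw [fourier_coe_apply, Real.fourierChar_apply]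
    congr 1
    push_cast
    ring
  have hcoeff := congrFun (fourierCoeff_fourier (T := 1) 0) (-k)
  simp only [fourierCoeff, neg_neg, fourier_zero, smul_eq_mul, mul_one, Pi.single_apply,
    neg_eq_zero] at hcoeff
  simp only [hcoe, integral_unitMeasure_coe fun t => fourier k t, hcoeff]

theorem zakInv_zak (hc : HasCompactSupport c) : zakInv (zak c) = c := by
  ext x
  have hsum := hasSum_integral_of_summable_integral_norm (μ := unitMeasure)
    (F := fun (k : ℤ) y => 𝐞 (-k * y) * c (x + k)) (fun k => ?_) ?_
  · have hcoeff (k : ℤ) : ∫ y, 𝐞 (-k * y) * c (x + k) ∂unitMeasure =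
        if k = 0 then c x else 0 := by
      rw [integral_mul_const, ← Int.cast_neg, integral_fourierChar_intCast_mul]
      by_cases hk : k = 0 <;> simp [hk]
    simp only [hcoeff] at hsum
    exact hsum.unique (hasSum_ite_eq 0 (c x))
  · exact (Continuous.integrableOn_Ioc (by fun_prop))
  · simp only [norm_mul, Circle.norm_coe, one_mul, integral_const, probReal_univ, one_smul]
    exact (summable_of_hasFiniteSupport (finite_support_add_intCast hc x)).norm

theorem memLp_zak (hc : HasCompactSupport c) (hcm : Measurable c) (x : ℝ) :
    MemLp (zak c x) 2 unitMeasure := by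
  refine MemLp.of_bound ((measurable_zak hc hcm).comp measurable_prodMk_left).aestronglyMeasurable
    (∑' k : ℤ, ‖c (x + k)‖) (Filter.Eventually.of_forall fun y => ?_)
  refine (norm_tsum_le_tsum_norm (summable_zak hc x y).norm).trans_eq (tsum_congr fun k => ?_)
  rw [norm_mul, Circle.norm_coe, one_mul]

theorem lintegral_enorm_sq_zak (hc : HasCompactSupport c) (hcm : Measurable c) :
    ∫⁻ z, ‖Function.uncurry (zak c) z‖ₑ ^ 2 ∂squareMeasure = ∫⁻ x, ‖c x‖ₑ ^ 2 := by
  have hadd (x y : ℝ) (k : ℤ) : 𝐞 (k * y) * zak c x y = zak c (x + k) y :=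
    (apply_add_intCast_left (zak_add_one_left c) x y k).symm
  rw [lintegral_eq_tsum_lintegral_unitMeasure, ← lintegral_tsum fun k => by fun_prop,
    lintegral_prod _ ((measurable_zak hc hcm).enorm.pow_const 2).aemeasurable]
  refine lintegral_congr fun x => ?_
  simp only [Function.uncurry_apply_pair, ← tsum_enorm_sq_integral_fourierChar_mul
    (memLp_zak hc hcm x), hadd]
  exact tsum_congr fun k => by rw [← zakInv, zakInv_zak hc]

theorem isQuasiPeriodic_zak (hc : HasCompactSupport c) (hcL : MemLp c 2 volume)
    (hcm : Measurable c) : IsQuasiPeriodic (zak c) where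
  measurable := measurable_zak hc hcm
  add_one_left := zak_add_one_left c
  add_one_right := zak_add_one_right c
  memLp := by
    refine ⟨(measurable_zak hc hcm).aestronglyMeasurable,
      (ENNReal.pow_lt_top_iff.1 (?_ : _ ^ 2 < ∞)).resolve_right two_ne_zero⟩
    rw [eLpNorm_two_sq_eq_lintegral,
      lintegral_enorm_sq_zak hc hcm, ← eLpNorm_two_sq_eq_lintegral]
    exact ENNReal.pow_lt_top hcL.2

theorem zakInv_zakDual_zak (hc : Integrable c) :
    zakInv (zakDual (zak c)) = star (𝓕 c) := by
  ext ξ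
  have hint : Integrable fun x => 𝐞 (-(x * ξ)) * c x :=
    hc.bdd_mul (c := 1) (by fun_prop) (Filter.Eventually.of_forall fun x => (Circle.norm_coe _).le)
  have hsum := (hasSum_integral_of_summable_integral_norm (μ := unitMeasure)
    (F := fun (k : ℤ) x => 𝐞 (-((x + k) * ξ)) * c (x + k))
    (fun k => (hint.comp_add_right (k : ℝ)).restrict)
    (hasSum_integral_unitMeasure hint.norm).summable).unique (hasSum_integral_unitMeasure hint)
  have hpoint (x : ℝ) : zakDual (zak c) ξ x =
      starRingEnd ℂ (∑' k : ℤ, 𝐞 (-((x + k) * ξ)) * c (x + k)) := by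
    have hterm (k : ℤ) : (𝐞 (-((x + k) * ξ)) : ℂ) * c (x + k) =
        𝐞 (-(x * ξ)) * (𝐞 (-k * ξ) * c (x + k)) := by
      rw [← mul_assoc, ← Circle.coe_mul, ← AddChar.map_add_eq_mul]
      ring_nf
    simp only [hterm, tsum_mul_left]
    rw [zakDual, map_mul (starRingEnd ℂ), ← Circle.coe_inv_eq_conj, ← AddChar.map_neg_eq_inv,
      neg_neg, zak]
  simp only [zakInv, hpoint, integral_conj, hsum]
  rw [Pi.star_apply, Real.fourier_real_eq]
  simp [Circle.smul_def]

end ZakTransform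

theorem isometry_star_Lp {α : Type*} [MeasurableSpace α] (μ : Measure α) (p : ℝ≥0∞)
    [Fact (1 ≤ p)] : Isometry (star : Lp ℂ p μ → Lp ℂ p μ) := fun f g => by
  rw [Lp.edist_def, Lp.edist_def]
  refine eLpNorm_congr_norm_ae ?_
  filter_upwards [Lp.coeFn_star f, Lp.coeFn_star g] with x hf hg
  simp only [Pi.sub_apply, hf, hg, Pi.star_apply, ← star_sub, norm_star]

theorem exists_quasiPeriodic_of_contDiff {c : ℝ → ℂ} {g : Lp ℂ 2 (volume : Measure ℝ)}
    (hgc : g =ᵐ[volume] c) (hc : HasCompactSupport c) (hcd : ContDiff ℝ (⊤ : ℕ∞) c) :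
    ∃ G, ∃ hG : IsQuasiPeriodic G, hG.memLp_zakInv.toLp _ = g ∧
      hG.zakDual.memLp_zakInv.toLp _ = star (𝓕 g) := by
  have hG := isQuasiPeriodic_zak hc ((memLp_congr_ae hgc).1 (Lp.memLp g))
    hcd.continuous.measurable
  refine ⟨zak c, hG, ?_, ?_⟩
  · exact Lp.ext (hG.memLp_zakInv.coeFn_toLp.trans ((zakInv_zak hc).eventuallyEq.trans hgc.symm))
  · let φ := hc.toSchwartzMap hcd
    have hφ : g = φ.toLp 2 := Lp.ext (hgc.trans (φ.coeFn_toLp 2).symm)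
    refine Lp.ext (hG.zakDual.memLp_zakInv.coeFn_toLp.trans ?_)
    rw [hφ, SchwartzMap.toLp_fourier_eq,
      zakInv_zakDual_zak (hcd.continuous.integrable_of_hasCompactSupport hc)]
    filter_upwards [Lp.coeFn_star ((𝓕 φ).toLp 2), (𝓕 φ).coeFn_toLp 2] with x hx₁ hx₂
    rw [hx₁, Pi.star_apply, Pi.star_apply, hx₂, SchwartzMap.fourier_coe]
    rfl

theorem exists_zakInv_eq (g : Lp ℂ 2 (volume : Measure ℝ)) :
    ∃ G, ∃ hG : IsQuasiPeriodic G, hG.memLp_zakInv.toLp _ = g ∧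
      hG.zakDual.memLp_zakInv.toLp _ = star (𝓕 g) := by
  obtain ⟨h, hh, hlim⟩ := mem_closure_iff_seq_limit.1
    (Lp.dense_hasCompactSupport_contDiff (p := 2) (by simp) g)
  choose c hc using hh
  choose G hG hGh hGF using fun n =>
    exists_quasiPeriodic_of_contDiff (hc n).1 (hc n).2.1 (hc n).2.2
  obtain ⟨H, hH, hGH⟩ := IsQuasiPeriodic.exists_tendsto hG
    (by simpa only [hGh] using hlim.cauchySeq)
  refine ⟨H, hH, tendsto_nhds_unique ?_ hlim, tendsto_nhds_unique ?_
    (((isometry_star_Lp volume 2).continuous.tendsto _).comp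
      (((Lp.fourierTransformₗᵢ ℝ ℂ).continuous.tendsto g).comp hlim))⟩
  · refine Filter.Tendsto.congr hGh ((Lp.tendsto_Lp_iff_tendsto_eLpNorm'' _ _ _ _).2 ?_)
    simpa only [(hG _).eLpNorm_zakInv_sub hH] using hGH
  · refine Filter.Tendsto.congr hGF ((Lp.tendsto_Lp_iff_tendsto_eLpNorm'' _ _ _ _).2 ?_)
    simpa only [(hG _).eLpNorm_zakInv_zakDual_sub hH] using hGH

section PlaneCharacters

/-- The character `(x, y) ↦ e^{2πi(nx - my)}` of the unit square, indexed by `(m, n)`. Under the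
Zak transform, multiplication by it corresponds to the time-frequency shift by `(m, n)`. -/
noncomputable def planeChar (i : ℤ × ℤ) (z : ℝ × ℝ) : ℂ := 𝐞 (i.2 * z.1) * 𝐞 (-i.1 * z.2)

@[fun_prop] theorem continuous_planeChar (i : ℤ × ℤ) : Continuous (planeChar i) := by
  unfold planeChar; fun_prop

theorem norm_planeChar (i : ℤ × ℤ) (z : ℝ × ℝ) : ‖planeChar i z‖ = 1 := by
  rw [planeChar, norm_mul, Circle.norm_coe, Circle.norm_coe, one_mul]

theorem memLp_planeChar (i : ℤ × ℤ) : MemLp (planeChar i) 2 squareMeasure :=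
  MemLp.of_bound (continuous_planeChar i).aestronglyMeasurable 1
    (Filter.Eventually.of_forall fun z => (norm_planeChar i z).le)

theorem conj_planeChar (i : ℤ × ℤ) (z : ℝ × ℝ) :
    starRingEnd ℂ (planeChar i z) = planeChar (-i) z := by
  simp only [planeChar, map_mul (starRingEnd ℂ), ← Circle.coe_inv_eq_conj,
    ← AddChar.map_neg_eq_inv, Prod.fst_neg, Prod.snd_neg, Int.cast_neg, neg_mul]

theorem planeChar_mul (i j : ℤ × ℤ) (z : ℝ × ℝ) :
    planeChar i z * planeChar j z = planeChar (i + j) z := by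
  simp only [planeChar, Prod.fst_add, Prod.snd_add, Int.cast_add, neg_add, add_mul,
    AddChar.map_add_eq_mul, Circle.coe_mul]
  ring

theorem integral_planeChar (i : ℤ × ℤ) :
    ∫ z, planeChar i z ∂squareMeasure = if i = 0 then 1 else 0 := by
  have hprod := integral_prod_mul (μ := unitMeasure) (ν := unitMeasure)
    (fun x : ℝ => (𝐞 (i.2 * x) : ℂ)) (fun y : ℝ => (𝐞 ((-i.1 : ℤ) * y) : ℂ))
  rw [integral_fourierChar_intCast_mul, integral_fourierChar_intCast_mul] at hprod
  simp only [Int.cast_neg] at hprod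
  refine hprod.trans ?_
  by_cases h₁ : i.1 = 0 <;> by_cases h₂ : i.2 = 0 <;> simp [h₁, h₂, Prod.ext_iff]

/-- `planeChar i` as an element of `L²`. -/
noncomputable def planeCharLp (i : ℤ × ℤ) : Lp ℂ 2 squareMeasure := (memLp_planeChar i).toLp _

theorem inner_planeCharLp (i : ℤ × ℤ) (f : Lp ℂ 2 squareMeasure) :
    inner ℂ (planeCharLp i) f = ∫ z, planeChar (-i) z * f z ∂squareMeasure := by
  rw [L2.inner_def]
  refine integral_congr_ae ?_
  filter_upwards [(memLp_planeChar i).coeFn_toLp] with z hz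
  rw [planeCharLp, hz, RCLike.inner_apply, conj_planeChar, mul_comm]

theorem orthonormal_planeCharLp : Orthonormal ℂ planeCharLp := by
  classical
  refine orthonormal_iff_ite.2 fun i j => ?_
  have hij : ∫ z, planeChar (-i) z * planeCharLp j z ∂squareMeasure =
      ∫ z, planeChar (-i + j) z ∂squareMeasure := by
    refine integral_congr_ae ?_
    filter_upwards [(memLp_planeChar j).coeFn_toLp] with z hz
    rw [planeCharLp, hz, planeChar_mul]
  rw [inner_planeCharLp, hij, integral_planeChar]
  simp only [neg_add_eq_zero]

theorem IsQuasiPeriodic.ae_eq_zero {G : ℝ → ℝ → ℂ} (hG : IsQuasiPeriodic G)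
    (h : ∀ i, ∫ z, planeChar i z * Function.uncurry G z ∂squareMeasure = 0) :
    Function.uncurry G =ᵐ[squareMeasure] 0 := by
  have hcoeff (m n : ℤ) : ∫ x, 𝐞 (n * x) * zakInv G (x + m) ∂unitMeasure = 0 := by
    rw [← h (-m, n), integral_prod]
    · refine integral_congr_ae (Filter.Eventually.of_forall fun x => ?_)
      simp only [hG.zakInv_add_intCast, planeChar, Function.uncurry_apply_pair, Int.cast_neg,
        neg_neg, mul_assoc]
      exact (integral_const_mul _ _).symm
    · exact (hG.memLp.integrable one_le_two).bdd_mul (c := 1) (by fun_prop)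
        (Filter.Eventually.of_forall fun z => (norm_planeChar _ z).le)
  have hzero : zakInv G =ᵐ[volume] 0 := by
    refine ae_iff_forall_ae_unitMeasure_add.2 fun m => ?_
    have hmem : MemLp (fun x => zakInv G (x + m)) 2 unitMeasure :=
      (hG.memLp_zakInv.comp_measurePreserving (measurePreserving_add_right _ _)).restrict _
    have hnorm := tsum_enorm_sq_integral_fourierChar_mul hmem
    rw [← eLpNorm_two_sq_eq_lintegral] at hnorm
    simp only [hcoeff, enorm_zero, ne_eq, OfNat.ofNat_ne_zero, not_false_eq_true, zero_pow,
      tsum_zero] at hnorm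
    exact (eLpNorm_eq_zero_iff hmem.aestronglyMeasurable two_ne_zero).1
      (pow_eq_zero_iff two_ne_zero |>.1 hnorm.symm)
  rw [← eLpNorm_eq_zero_iff hG.memLp.aestronglyMeasurable two_ne_zero, ← hG.eLpNorm_zakInv,
    eLpNorm_congr_ae hzero, eLpNorm_zero]

theorem dense_span_planeCharLp : Dense (Submodule.span ℂ (Set.range planeCharLp) :
    Set (Lp ℂ 2 squareMeasure)) := by
  rw [Submodule.dense_iff_topologicalClosure_eq_top, Submodule.topologicalClosure_eq_top_iff,
    Submodule.eq_bot_iff]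
  intro f hf
  have hG := isQuasiPeriodic_quasiPeriodicExt (Lp.stronglyMeasurable f).measurable (Lp.memLp f)
  refine (Lp.eq_zero_iff_ae_eq_zero).2 ((quasiPeriodicExt_ae_eq f).symm.trans
    (hG.ae_eq_zero fun i => ?_))
  have hinner : inner ℂ (planeCharLp (-i)) f = 0 := hf _ (Submodule.subset_span ⟨-i, rfl⟩)
  rw [inner_planeCharLp, neg_neg] at hinner
  rw [← hinner]
  refine integral_congr_ae ((quasiPeriodicExt_ae_eq f).mono fun z hz => ?_)
  simp only [hz]

end PlaneCharacters

section Multiplier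

variable {α : Type*} [MeasurableSpace α] {μ : Measure α} {M : α → ℂ}
  {D : Set (Lp ℂ 2 μ)} {a b : ℝ≥0∞}

theorem eLpNorm_mul_le_of_dense (hM : AEStronglyMeasurable M μ) (hD : Dense D) (hb : b ≠ ∞)
    (h : ∀ P ∈ D, eLpNorm (M * ⇑P) 2 μ ≤ b * ‖P‖ₑ) (f : Lp ℂ 2 μ) :
    eLpNorm (M * ⇑f) 2 μ ≤ b * ‖f‖ₑ := by
  obtain ⟨P, hPD, hP⟩ := mem_closure_iff_seq_limit.1 (hD f)
  obtain ⟨ns, hns, hae⟩ := (tendstoInMeasure_of_tendsto_Lp hP).exists_seq_tendsto_ae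
  have hfatou : eLpNorm (M * ⇑f) 2 μ ≤
      Filter.liminf (fun n => eLpNorm (M * ⇑(P (ns n))) 2 μ) Filter.atTop :=
    Lp.eLpNorm_lim_le_liminf_eLpNorm (fun n => hM.mul (Lp.aestronglyMeasurable _)) _
      (hae.mono fun z hz => hz.const_mul _)
  have hlim : Filter.Tendsto (fun n => b * ‖P (ns n)‖ₑ) Filter.atTop (nhds (b * ‖f‖ₑ)) :=
    ENNReal.Tendsto.const_mul ((hP.comp hns.tendsto_atTop).enorm) (Or.inr hb)
  exact hfatou.trans ((Filter.liminf_le_liminf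
    (Filter.Eventually.of_forall fun n => h _ (hPD _))).trans hlim.liminf_eq.le)

theorem le_eLpNorm_mul_of_dense (hM : AEStronglyMeasurable M μ) (hD : Dense D) (ha : a ≠ ∞)
    (hb : b ≠ ∞) (h : ∀ P ∈ D, a * ‖P‖ₑ ≤ eLpNorm (M * ⇑P) 2 μ)
    (hbdd : ∀ f : Lp ℂ 2 μ, eLpNorm (M * ⇑f) 2 μ ≤ b * ‖f‖ₑ) (f : Lp ℂ 2 μ) :
    a * ‖f‖ₑ ≤ eLpNorm (M * ⇑f) 2 μ := by
  have hmem (u : Lp ℂ 2 μ) : MemLp (M * ⇑u) 2 μ := ⟨hM.mul (Lp.aestronglyMeasurable u),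
    (hbdd u).trans_lt (ENNReal.mul_lt_top hb.lt_top enorm_lt_top)⟩
  obtain ⟨P, hPD, hP⟩ := mem_closure_iff_seq_limit.1 (hD f)
  have hlim : Filter.Tendsto (fun n => (hmem (P n)).toLp _) Filter.atTop
      (nhds ((hmem f).toLp _)) := by
    rw [Lp.tendsto_Lp_iff_tendsto_eLpNorm'']
    have hzero : Filter.Tendsto (fun n => b * ‖P n - f‖ₑ) Filter.atTop (nhds 0) := by
      simpa using ENNReal.Tendsto.const_mul (hP.sub_const f).enorm (Or.inr hb)
    refine tendsto_of_tendsto_of_tendsto_of_le_of_le tendsto_const_nhds hzero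
      (fun _ => zero_le) fun n => ?_
    refine le_trans (eLpNorm_congr_ae ?_).le (hbdd (P n - f))
    filter_upwards [Lp.coeFn_sub (P n) f] with z hz
    simp only [Pi.sub_apply, Pi.mul_apply, hz, mul_sub]
  refine le_of_tendsto_of_tendsto' (ENNReal.Tendsto.const_mul hP.enorm (Or.inr ha)) ?_
    fun n => h _ (hPD n)
  simpa only [Lp.enorm_toLp] using hlim.enorm

theorem eLpNorm_mul_indicator_one_sq {s : Set α} (hs : MeasurableSet s) (hμs : μ s ≠ ∞) :
    eLpNorm (M * ⇑(indicatorConstLp 2 hs hμs (1 : ℂ))) 2 μ ^ 2 = ∫⁻ z in s, ‖M z‖ₑ ^ 2 ∂μ := by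
  rw [eLpNorm_two_sq_eq_lintegral, ← lintegral_indicator hs]
  refine lintegral_congr_ae ?_
  filter_upwards [indicatorConstLp_coeFn (p := 2) (hs := hs) (hμs := hμs) (c := (1 : ℂ))] with z hz
  rw [Pi.mul_apply, hz]
  by_cases hzs : z ∈ s <;> simp [hzs]

theorem enorm_indicatorConstLp_one_sq {s : Set α} (hs : MeasurableSet s) (hμs : μ s ≠ ∞) :
    ‖indicatorConstLp 2 hs hμs (1 : ℂ)‖ₑ ^ 2 = μ s := by
  rw [Lp.enorm_def, eLpNorm_congr_ae (indicatorConstLp_coeFn (μ := μ)),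
    eLpNorm_indicator_const hs two_ne_zero ENNReal.ofNat_ne_top, enorm_one, one_mul,
    ← ENNReal.rpow_natCast, ← ENNReal.rpow_mul]
  norm_num

theorem ae_enorm_le_of_eLpNorm_mul_le [SigmaFinite μ] (hM : Measurable M)
    (h : ∀ f : Lp ℂ 2 μ, eLpNorm (M * ⇑f) 2 μ ≤ b * ‖f‖ₑ) : ∀ᵐ z ∂μ, ‖M z‖ₑ ≤ b := by
  have hsq : (fun z => ‖M z‖ₑ ^ 2) ≤ᵐ[μ] fun _ => b ^ 2 := by
    refine ae_le_of_forall_setLIntegral_le_of_sigmaFinite (hM.enorm.pow_const 2) fun s hs hμs => ?_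
    have hind := pow_le_pow_left₀ zero_le (h (indicatorConstLp 2 hs hμs.ne 1)) 2
    rwa [mul_pow, eLpNorm_mul_indicator_one_sq, enorm_indicatorConstLp_one_sq,
      ← setLIntegral_const] at hind
  exact hsq.mono fun z hz => (ENNReal.pow_le_pow_left_iff two_ne_zero).1 hz

theorem ae_le_enorm_of_le_eLpNorm_mul [SigmaFinite μ]
    (h : ∀ f : Lp ℂ 2 μ, a * ‖f‖ₑ ≤ eLpNorm (M * ⇑f) 2 μ) : ∀ᵐ z ∂μ, a ≤ ‖M z‖ₑ := by
  have hsq : (fun _ => a ^ 2) ≤ᵐ[μ] fun z => ‖M z‖ₑ ^ 2 := by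
    refine ae_le_of_forall_setLIntegral_le_of_sigmaFinite measurable_const fun s hs hμs => ?_
    have hind := pow_le_pow_left₀ zero_le (h (indicatorConstLp 2 hs hμs.ne 1)) 2
    rwa [mul_pow, eLpNorm_mul_indicator_one_sq, enorm_indicatorConstLp_one_sq,
      ← setLIntegral_const] at hind
  exact hsq.mono fun z hz => (ENNReal.pow_le_pow_left_iff two_ne_zero).1 hz

end Multiplier

section RieszBounds

/-- The trigonometric polynomial on the unit square with coefficients `a`. -/
noncomputable def trigPoly (a : ℤ × ℤ →₀ ℂ) (z : ℝ × ℝ) : ℂ := a.sum fun i c => c * planeChar i z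

theorem continuous_trigPoly (a : ℤ × ℤ →₀ ℂ) : Continuous (trigPoly a) := by
  unfold trigPoly Finsupp.sum; fun_prop

theorem norm_trigPoly_le (a : ℤ × ℤ →₀ ℂ) (z : ℝ × ℝ) : ‖trigPoly a z‖ ≤ ∑ i ∈ a.support, ‖a i‖ :=
  (norm_sum_le _ _).trans_eq
    (Finset.sum_congr rfl fun i _ => by rw [norm_mul, norm_planeChar, mul_one])

theorem coeFn_sum_planeCharLp (a : ℤ × ℤ →₀ ℂ) :
    ⇑(a.sum fun i c => c • planeCharLp i) =ᵐ[squareMeasure] trigPoly a := by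
  have hterm : ∀ᵐ z ∂squareMeasure, ∀ i, (a i • planeCharLp i) z = a i * planeChar i z := by
    refine ae_all_iff.2 fun i => ?_
    filter_upwards [Lp.coeFn_smul (a i) (planeCharLp i), (memLp_planeChar i).coeFn_toLp]
      with z hsmul htoLp
    rw [hsmul, Pi.smul_apply, planeCharLp, htoLp, smul_eq_mul]
  filter_upwards [Lp.coeFn_finsetSum a.support fun i => a i • planeCharLp i, hterm]
    with z hsum hterm
  rw [Finsupp.sum, hsum, trigPoly, Finsupp.sum, Finset.sum_apply]
  exact Finset.sum_congr rfl fun i _ => hterm i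

theorem norm_sq_sum_planeCharLp (a : ℤ × ℤ →₀ ℂ) :
    ‖a.sum fun i c => c • planeCharLp i‖ ^ 2 = a.sum fun _ c => ‖c‖ ^ 2 := by
  have h := orthonormal_planeCharLp.inner_sum a a a.support
  simp only [RCLike.conj_mul] at h
  rw [inner_self_eq_norm_sq_to_K] at h
  exact_mod_cast h

namespace IsQuasiPeriodic

variable {G : ℝ → ℝ → ℂ} {g : Lp ℂ 2 (volume : Measure ℝ)} {A B : ℝ}

theorem trigPoly_mul (hG : IsQuasiPeriodic G) (a : ℤ × ℤ →₀ ℂ) :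
    IsQuasiPeriodic fun x y => trigPoly a (x, y) * G x y where
  measurable := (continuous_trigPoly a).measurable.mul hG.measurable
  add_one_left x y := by
    simp only [trigPoly, planeChar, mul_add, mul_one, AddChar.map_add_eq_mul,
      fourierChar_intCast, hG.add_one_left]
    ring
  add_one_right x y := by
    simp only [trigPoly, planeChar, mul_add, mul_one, AddChar.map_add_eq_mul, ← Int.cast_neg,
      fourierChar_intCast, hG.add_one_right]
  memLp := hG.memLp.of_le_mul (c := ∑ i ∈ a.support, ‖a i‖)
    ((continuous_trigPoly a).measurable.mul hG.measurable).aestronglyMeasurable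
    (Filter.Eventually.of_forall fun z => (norm_mul _ _).trans_le
      (mul_le_mul_of_nonneg_right (norm_trigPoly_le a z) (norm_nonneg _)))

theorem zakInv_trigPoly_mul (hG : IsQuasiPeriodic G) (a : ℤ × ℤ →₀ ℂ) :
    zakInv (fun x y => trigPoly a (x, y) * G x y) =ᵐ[volume]
      fun x => a.sum fun i c => c * (𝐞 (i.2 * x) * zakInv G (x - i.1)) := by
  filter_upwards [hG.ae_integrable] with x hx
  have hexpand (y : ℝ) : trigPoly a (x, y) * G x y = ∑ i ∈ a.support,
      (a i * 𝐞 (i.2 * x)) * (𝐞 ((-i.1 : ℤ) * y) * G x y) := by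
    rw [trigPoly, Finsupp.sum, Finset.sum_mul]
    refine Finset.sum_congr rfl fun i _ => ?_
    rw [planeChar, Int.cast_neg]
    ring
  simp only [zakInv, hexpand]
  rw [integral_finsetSum, Finsupp.sum]
  · refine Finset.sum_congr rfl fun i _ => ?_
    rw [integral_const_mul, ← hG.zakInv_add_intCast, Int.cast_neg, ← sub_eq_add_neg, mul_assoc]
    rfl
  · exact fun i _ => (hx.bdd_mul (c := 1) (by fun_prop)
      (Filter.Eventually.of_forall fun y => (Circle.norm_coe _).le)).const_mul _

theorem gaborSystem_ae_eq (hg : zakInv G =ᵐ[volume] g) (i : ℤ × ℤ) :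
    gaborSystem g i =ᵐ[volume] fun x => 𝐞 (i.2 * x) * zakInv G (x - i.1) := by
  filter_upwards [(memLp_timeFreqShift (Lp.memLp g) i.1 i.2).coeFn_toLp,
    (measurePreserving_sub_right volume (i.1 : ℝ)).quasiMeasurePreserving.ae hg] with x hshift hgx
  rw [gaborSystem, hshift, hgx, timeFreqShift, Real.fourierChar_apply]
  congr 2
  push_cast
  ring

theorem enorm_sum_gaborSystem (hG : IsQuasiPeriodic G) (hg : zakInv G =ᵐ[volume] g)
    (a : ℤ × ℤ →₀ ℂ) :
    ‖a.sum fun i c => c • gaborSystem g i‖ₑ =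
      eLpNorm (Function.uncurry G * ⇑(a.sum fun i c => c • planeCharLp i)) 2 squareMeasure := by
  have hmul : (Function.uncurry G * ⇑(a.sum fun i c => c • planeCharLp i)) =ᵐ[squareMeasure]
      Function.uncurry fun x y => trigPoly a (x, y) * G x y := by
    filter_upwards [coeFn_sum_planeCharLp a] with z hz
    rw [Pi.mul_apply, hz, mul_comm]
    rfl
  rw [eLpNorm_congr_ae hmul, ← (hG.trigPoly_mul a).eLpNorm_zakInv, Lp.enorm_def]
  refine eLpNorm_congr_ae ?_
  have hterm : ∀ᵐ x, ∀ i, (a i • gaborSystem g i) x =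
      a i * (𝐞 (i.2 * x) * zakInv G (x - i.1)) := by
    refine ae_all_iff.2 fun i => ?_
    filter_upwards [Lp.coeFn_smul (a i) (gaborSystem g i), gaborSystem_ae_eq hg i]
      with x hsmul hx
    rw [hsmul, Pi.smul_apply, hx, smul_eq_mul]
  filter_upwards [Lp.coeFn_finsetSum a.support fun i => a i • gaborSystem g i, hterm,
    hG.zakInv_trigPoly_mul a] with x hsum hterm hzak
  rw [hzak, Finsupp.sum, hsum, Finsupp.sum, Finset.sum_apply]
  exact Finset.sum_congr rfl fun i _ => hterm i

end IsQuasiPeriodic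

theorem IsRieszBasisWithBounds.finsupp_bounds {ι H : Type*} [NormedAddCommGroup H]
    [InnerProductSpace ℂ H] [CompleteSpace H] {A B : ℝ} {f : ι → H}
    (h : IsRieszBasisWithBounds A B f) (a : ι →₀ ℂ) :
    A * (a.sum fun _ c => ‖c‖ ^ 2) ≤ ‖a.sum fun i c => c • f i‖ ^ 2 ∧
      ‖a.sum fun i c => c • f i‖ ^ 2 ≤ B * (a.sum fun _ c => ‖c‖ ^ 2) := by
  have hmem : Memℓp a 2 := (memℓp_zero a.hasFiniteSupport).of_exponent_ge zero_le
  have hnorm : ∑' i, ‖a i‖ ^ 2 = a.sum fun _ c => ‖c‖ ^ 2 :=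
    tsum_eq_sum fun i hi => by simp [Finsupp.notMem_support_iff.1 hi]
  have hsum : ∑' i, a i • f i = a.sum fun i c => c • f i :=
    tsum_eq_sum fun i hi => by simp [Finsupp.notMem_support_iff.1 hi]
  rw [← hnorm, ← hsum]
  exact ⟨h.lower ⟨fun i => a i, hmem⟩, h.upper ⟨fun i => a i, hmem⟩⟩

theorem IsQuasiPeriodic.span_planeCharLp_bounds {G : ℝ → ℝ → ℂ} {g : Lp ℂ 2 (volume : Measure ℝ)}
    {A B : ℝ} (hG : IsQuasiPeriodic G) (hg : zakInv G =ᵐ[volume] g)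
    (h : IsRieszBasisWithBounds A B (gaborSystem g)) {P : Lp ℂ 2 squareMeasure}
    (hP : P ∈ Submodule.span ℂ (Set.range planeCharLp)) :
    ENNReal.ofReal √A * ‖P‖ₑ ≤ eLpNorm (Function.uncurry G * ⇑P) 2 squareMeasure ∧
      eLpNorm (Function.uncurry G * ⇑P) 2 squareMeasure ≤ ENNReal.ofReal √B * ‖P‖ₑ := by
  obtain ⟨a, rfl⟩ := Finsupp.mem_span_range_iff_exists_finsupp.1 hP
  obtain ⟨hlower, hupper⟩ := h.finsupp_bounds a
  rw [← norm_sq_sum_planeCharLp] at hlower hupper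
  rw [← hG.enorm_sum_gaborSystem hg, ← ofReal_norm, ← ofReal_norm,
    ← ENNReal.ofReal_mul (Real.sqrt_nonneg _), ← ENNReal.ofReal_mul (Real.sqrt_nonneg _)]
  refine ⟨ENNReal.ofReal_le_ofReal (pow_le_pow_iff_left₀ (by positivity) (norm_nonneg _)
    two_ne_zero |>.1 ?_),
    ENNReal.ofReal_le_ofReal (pow_le_pow_iff_left₀ (norm_nonneg _) (by positivity)
    two_ne_zero |>.1 ?_)⟩
  · rwa [mul_pow, Real.sq_sqrt h.lower_pos.le]
  · rwa [mul_pow, Real.sq_sqrt h.upper_pos.le]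

theorem IsQuasiPeriodic.ae_bounds {G : ℝ → ℝ → ℂ} {g : Lp ℂ 2 (volume : Measure ℝ)}
    {A B : ℝ} (hG : IsQuasiPeriodic G) (hg : zakInv G =ᵐ[volume] g)
    (h : IsRieszBasisWithBounds A B (gaborSystem g)) :
    ∀ᵐ z ∂squareMeasure, √A ≤ ‖Function.uncurry G z‖ ∧ ‖Function.uncurry G z‖ ≤ √B := by
  have hbounds {P} (hP : P ∈ Submodule.span ℂ (Set.range planeCharLp)) :=
    hG.span_planeCharLp_bounds hg h hP
  have hM := hG.memLp.aestronglyMeasurable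
  have hupper := eLpNorm_mul_le_of_dense hM dense_span_planeCharLp ENNReal.ofReal_ne_top
    fun P hP => (hbounds hP).2
  have hlower := le_eLpNorm_mul_of_dense hM dense_span_planeCharLp ENNReal.ofReal_ne_top
    ENNReal.ofReal_ne_top (fun P hP => (hbounds hP).1) hupper
  filter_upwards [ae_enorm_le_of_eLpNorm_mul_le hG.measurable hupper,
    ae_le_enorm_of_le_eLpNorm_mul hlower] with z hle hge
  rw [← ofReal_norm, ENNReal.ofReal_le_ofReal_iff (by positivity)] at hle hge
  exact ⟨hge, hle⟩

end RieszBounds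

section DiscreteWinding

theorem abs_arg_lt_pi_div_three {z : ℂ} (hz : ‖z - 1‖ < 1 / 3) : |z.arg| < Real.pi / 3 := by
  have hre := (abs_lt.1 ((Complex.abs_re_le_norm (z - 1)).trans_lt hz)).1
  rw [Complex.sub_re, Complex.one_re] at hre
  have hnorm : ‖z‖ < 4 / 3 := by
    have htri := norm_sub_norm_le z 1
    rw [norm_one] at htri
    linarith
  have hz0 : z ≠ 0 := by
    rintro rfl
    norm_num at hre
  by_contra! hge
  have hcos := Real.cos_le_cos_of_nonneg_of_le_pi (by positivity) (Complex.abs_arg_le_pi z) hge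
  rw [Real.cos_abs, Complex.cos_arg hz0, Real.cos_pi_div_three,
    div_le_iff₀ (norm_pos_iff.2 hz0)] at hcos
  linarith

theorem abs_arg_div_lt_pi_div_three {x y : ℂ} {c : ℝ} (hy : 3 * c ≤ ‖y‖) (hxy : ‖x - y‖ < c) :
    |(x / y).arg| < Real.pi / 3 := by
  have hy0 : 0 < ‖y‖ := by linarith [norm_nonneg (x - y)]
  refine abs_arg_lt_pi_div_three ?_
  rw [div_sub_one (norm_pos_iff.1 hy0), norm_div, div_lt_iff₀ hy0]
  linarith

theorem eq_of_coe_angle_eq_of_abs_sub_lt {s t : ℝ} (h : (s : Real.Angle) = t)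
    (hst : |s - t| < 2 * Real.pi) : s = t := by
  obtain ⟨n, hn⟩ := Real.Angle.angle_eq_iff_two_pi_dvd_sub.1 h
  rw [hn, abs_mul, abs_of_pos Real.two_pi_pos, mul_lt_iff_lt_one_right Real.two_pi_pos] at hst
  have hn0 : n = 0 := Int.abs_lt_one_iff.1 (by exact_mod_cast hst)
  rwa [hn0, Int.cast_zero, mul_zero, sub_eq_zero] at hn

theorem arg_div_add_arg_div {a b c d : ℂ} (ha : a ≠ 0) (hb : b ≠ 0) (hc : c ≠ 0) (hd : d ≠ 0)
    (hab : |(b / a).arg| < Real.pi / 3) (hac : |(c / a).arg| < Real.pi / 3)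
    (hbd : |(d / b).arg| < Real.pi / 3) :
    (b / a).arg + (d / b).arg = (c / a).arg + (d / c).arg := by
  refine eq_of_coe_angle_eq_of_abs_sub_lt ?_ ?_
  · simp only [Real.Angle.coe_add, Complex.arg_div_coe_angle, ne_eq, ha, hb, hc, hd,
      not_false_eq_true]
    abel
  · have hcd := abs_le.1 (Complex.abs_arg_le_pi (d / c))
    rw [abs_lt] at hab hac hbd ⊢
    constructor <;> linarith

/-- The total variation of the argument along the polygon with vertices `z 0, …, z M`. If the
polygon is closed, this is `2π` times a discrete winding number around `0`. -/
noncomputable def totalTurning (z : ℕ → ℂ) (M : ℕ) : ℝ :=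
  ∑ j ∈ Finset.range M, (z (j + 1) / z j).arg

theorem totalTurning_eq_of_abs_arg_lt {z w : ℕ → ℂ} {M : ℕ} (hz : ∀ j ≤ M, z j ≠ 0)
    (hw : ∀ j ≤ M, w j ≠ 0) (hzM : z M = z 0) (hwM : w M = w 0)
    (hzz : ∀ j < M, |(z (j + 1) / z j).arg| < Real.pi / 3)
    (hzw : ∀ j ≤ M, |(w j / z j).arg| < Real.pi / 3) :
    totalTurning w M = totalTurning z M := by
  have hcell : ∀ j ∈ Finset.range M, (w (j + 1) / w j).arg - (z (j + 1) / z j).arg =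
      (w (j + 1) / z (j + 1)).arg - (w j / z j).arg := fun j hj => by
    have hj := Finset.mem_range.1 hj
    linarith [arg_div_add_arg_div (hz j hj.le) (hz _ hj) (hw j hj.le) (hw _ hj) (hzz j hj)
      (hzw j hj.le) (hzw (j + 1) hj)]
  rw [← sub_eq_zero, totalTurning, totalTurning, ← Finset.sum_sub_distrib,
    Finset.sum_congr rfl hcell, Finset.sum_range_sub (fun j => (w j / z j).arg), hzM, hwM, sub_self]

theorem arg_fourierChar {t : ℝ} (ht : 2 * |t| < 1) : (𝐞 t : ℂ).arg = 2 * Real.pi * t := by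
  have htpi : |2 * Real.pi * t| < Real.pi := by
    rw [abs_mul, abs_of_pos Real.two_pi_pos]
    nlinarith [Real.pi_pos]
  rw [Real.fourierChar_apply, Complex.arg_exp_mul_I]
  exact (toIocMod_eq_self _).2 ⟨(abs_lt.1 htpi).1, by linarith [(abs_lt.1 htpi).2]⟩

theorem totalTurning_fourierChar_mul {z : ℕ → ℂ} {M : ℕ} (hM : 3 ≤ M) (v : ℝ)
    (hz : ∀ j ≤ M, z j ≠ 0) (hzz : ∀ j < M, |(z (j + 1) / z j).arg| < Real.pi / 3) :
    totalTurning (fun j => 𝐞 (v + j / M) * z j) M = totalTurning z M + 2 * Real.pi := by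
  have hM3 : (3 : ℝ) ≤ M := by exact_mod_cast hM
  have hinv : 1 / (M : ℝ) ≤ 1 / 3 := by gcongr
  have hinv0 : 0 < 1 / (M : ℝ) := by positivity
  have hstep : ∀ j ∈ Finset.range M,
      (𝐞 (v + (j + 1 : ℕ) / M) * z (j + 1) / (𝐞 (v + j / M) * z j)).arg =
        (z (j + 1) / z j).arg + 2 * Real.pi * (1 / M) := fun j hj => by
    have hj := Finset.mem_range.1 hj
    have hzj := hz j hj.le
    have hratio : (𝐞 (v + (j + 1 : ℕ) / M) * z (j + 1) / (𝐞 (v + j / M) * z j) : ℂ) =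
        𝐞 (1 / M) * (z (j + 1) / z j) := by
      have hshift : v + ((j + 1 : ℕ) : ℝ) / M = 1 / M + (v + j / M) := by push_cast; ring
      rw [hshift, AddChar.map_add_eq_mul, Circle.coe_mul]
      field_simp [Circle.coe_ne_zero]
    have harg : (𝐞 (1 / M : ℝ) : ℂ).arg = 2 * Real.pi * (1 / M) :=
      arg_fourierChar (by rw [abs_of_pos hinv0]; linarith)
    have harg_z := abs_lt.1 (hzz j hj)
    rw [hratio, (Complex.arg_mul_eq_add_arg_iff (Circle.coe_ne_zero _)
      (div_ne_zero (hz _ hj) hzj)).2, harg, add_comm]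
    rw [harg]
    constructor <;> nlinarith [Real.pi_pos]
  rw [totalTurning, Finset.sum_congr rfl hstep, Finset.sum_add_distrib, Finset.sum_const,
    Finset.card_range, nsmul_eq_mul, totalTurning]
  field_simp

theorem exists_pi_div_three_le_abs_arg {F : ℕ → ℕ → ℂ} {K M : ℕ} (hK : 0 < K) (hM : 3 ≤ M) (v : ℝ)
    (hne : ∀ i ≤ K, ∀ j ≤ M, F i j ≠ 0) (hper : ∀ i, F i M = F i 0)
    (htwist : ∀ j, F K j = 𝐞 (v + j / M) * F 0 j) :
    ∃ i < K, (∃ j ≤ M, Real.pi / 3 ≤ |(F (i + 1) j / F i j).arg|) ∨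
      ∃ j < M, Real.pi / 3 ≤ |(F i (j + 1) / F i j).arg| := by
  by_contra! hsmall
  have hconst : ∀ i ≤ K, totalTurning (F i) M = totalTurning (F 0) M := fun i => by
    induction i with
    | zero => exact fun _ => rfl
    | succ i ih =>
      exact fun hi => (totalTurning_eq_of_abs_arg_lt (hne i (by omega)) (hne _ hi) (hper i)
        (hper _) (hsmall i hi).2 (hsmall i hi).1).trans (ih (by omega))
  have htwisted := totalTurning_fourierChar_mul hM v (hne 0 K.zero_le) (hsmall 0 hK).2
  rw [← funext htwist, hconst K le_rfl] at htwisted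
  linarith [Real.pi_pos]

end DiscreteWinding

section Jumps

theorem IsQuasiPeriodic.exists_jump {G : ℝ → ℝ → ℂ} (hG : IsQuasiPeriodic G) {δ : ℝ} (hδ : 0 < δ)
    {K M : ℕ} (hK : 0 < K) (hM : 3 ≤ M) {u v : ℝ}
    (hlow : ∀ i < K, ∀ j < M, 3 * δ ≤ ‖G (u + i / K) (v + j / M)‖) :
    ∃ i < K, ∃ j < M,
      δ ≤ ‖G (u + i / K + 1 / K) (v + j / M) - G (u + i / K) (v + j / M)‖ ∨
      δ ≤ ‖G (u + i / K) (v + j / M + 1 / M) - G (u + i / K) (v + j / M)‖ := by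
  have hK0 : (K : ℝ) ≠ 0 := by positivity
  have hM0 : (M : ℝ) ≠ 0 := by positivity
  by_contra! hsmall
  let F (i j : ℕ) : ℂ := G (u + i / K) (v + j / M)
  have hsucc (a b : ℝ) (n : ℕ) : a + (n + 1 : ℕ) / b = a + n / b + 1 / b := by push_cast; ring
  have hper (i : ℕ) : F i M = F i 0 := by
    simp only [F, div_self hM0, hG.add_one_right, Nat.cast_zero, zero_div, add_zero]
  have htwist (j : ℕ) : F K j = 𝐞 (v + j / M) * F 0 j := by
    simp only [F, div_self hK0, hG.add_one_left, Nat.cast_zero, zero_div, add_zero]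
  have hlow' : ∀ i < K, ∀ j ≤ M, 3 * δ ≤ ‖F i j‖ := fun i hi j hj => by
    rcases hj.lt_or_eq with hj | rfl
    · exact hlow i hi j hj
    · exact hper i ▸ hlow i hi 0 (by omega)
  have hne_of_lt : ∀ i < K, ∀ j ≤ M, F i j ≠ 0 := fun i hi j hj =>
    norm_pos_iff.1 (by linarith [hlow' i hi j hj])
  have hne : ∀ i ≤ K, ∀ j ≤ M, F i j ≠ 0 := fun i hi j hj => by
    rcases hi.lt_or_eq with hi | rfl
    · exact hne_of_lt i hi j hj
    · exact htwist j ▸ mul_ne_zero (Circle.coe_ne_zero _) (hne_of_lt 0 hK j hj)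
  have hleft : ∀ i < K, ∀ j ≤ M, ‖F (i + 1) j - F i j‖ < δ := fun i hi j hj => by
    rcases hj.lt_or_eq with hj | rfl
    · simpa only [F, hsucc] using (hsmall i hi j hj).1
    · rw [hper, hper]
      simpa only [F, hsucc] using (hsmall i hi 0 (by omega)).1
  have hright : ∀ i < K, ∀ j < M, ‖F i (j + 1) - F i j‖ < δ := fun i hi j hj => by
    simpa only [F, hsucc] using (hsmall i hi j hj).2
  obtain ⟨i, hi, ⟨j, hj, hjump⟩ | ⟨j, hj, hjump⟩⟩ :=
    exists_pi_div_three_le_abs_arg hK hM v hne hper htwist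
  · exact hjump.not_gt (abs_arg_div_lt_pi_div_three (hlow' i hi j hj) (hleft i hi j hj))
  · exact hjump.not_gt (abs_arg_div_lt_pi_div_three (hlow' i hi j hj.le) (hright i hi j hj))

theorem squareMeasure_eq_volume_inter {S : Set (ℝ × ℝ)} (hS : MeasurableSet S) :
    squareMeasure S = volume (S ∩ Set.Ioc 0 1 ×ˢ Set.Ioc 0 1) := by
  rw [squareMeasure, Measure.prod_restrict, Measure.restrict_apply hS, Measure.volume_eq_prod]

theorem ceil_mul_sub_one_eq_iff {K : ℕ} (hK : 0 < K) (i : ℕ) (x : ℝ) :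
    ⌈K * x⌉ - 1 = (i : ℤ) ↔ x - i / K ∈ Set.Ioc 0 (1 / (K : ℝ)) := by
  have hK0 : (0 : ℝ) < K := by positivity
  rw [sub_eq_iff_eq_add, Int.ceil_eq_iff, Set.mem_Ioc, sub_pos, div_lt_iff₀ hK0,
    sub_le_iff_le_add, ← add_div, le_div_iff₀ hK0]
  push_cast
  rw [mul_comm x, add_sub_cancel_right, add_comm (1 : ℝ)]

theorem mem_Ioc_zero_one_of_sub_mem {K i : ℕ} (hi : i < K) {x : ℝ}
    (hx : x - i / K ∈ Set.Ioc 0 (1 / (K : ℝ))) : x ∈ Set.Ioc (0 : ℝ) 1 := by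
  have hK0 : (0 : ℝ) < K := by exact_mod_cast Nat.zero_lt_of_lt hi
  have hiK : (i : ℝ) / K + 1 / K ≤ 1 := by
    rw [← add_div, div_le_one hK0]
    exact_mod_cast hi
  have hi0 : 0 ≤ (i : ℝ) / K := by positivity
  constructor <;> linarith [hx.1, hx.2]

theorem inv_mul_le_squareMeasure {S : Set (ℝ × ℝ)} (hS : MeasurableSet S) {K M : ℕ} (hK : 0 < K)
    (hM : 0 < M)
    (h : ∀ u v : ℝ, ∃ i < K, ∃ j < M, (u + (i : ℝ) / K, v + (j : ℝ) / M) ∈ S) :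
    ENNReal.ofReal (1 / (K * M)) ≤ squareMeasure S := by
  let Q : Set (ℝ × ℝ) := Set.Ioc 0 (1 / (K : ℝ)) ×ˢ Set.Ioc 0 (1 / (M : ℝ))
  have hQ : MeasurableSet Q := measurableSet_Ioc.prod measurableSet_Ioc
  let c (n : ℕ × ℕ) : ℝ × ℝ := ((n.1 : ℝ) / K, (n.2 : ℝ) / M)
  let I := Finset.range K ×ˢ Finset.range M
  have hcover : Q ⊆ ⋃ n ∈ I, (fun z => z + c n) ⁻¹' (S ∩ (fun z => z - c n) ⁻¹' Q) := by
    intro z hz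
    obtain ⟨i, hi, j, hj, hij⟩ := h z.1 z.2
    refine Set.mem_biUnion (x := (i, j))
      (Finset.mem_product.2 ⟨Finset.mem_range.2 hi, Finset.mem_range.2 hj⟩) ⟨hij, ?_⟩
    simpa using hz
  have hdisj : (I : Set (ℕ × ℕ)).PairwiseDisjoint fun n => S ∩ (fun z => z - c n) ⁻¹' Q := by
    let cell (z : ℝ × ℝ) : ℤ × ℤ := (⌈K * z.1⌉ - 1, ⌈M * z.2⌉ - 1)
    have hcell {n : ℕ × ℕ} {z : ℝ × ℝ} (hz : z - c n ∈ Q) : cell z = ((n.1 : ℤ), (n.2 : ℤ)) :=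
      Prod.ext ((ceil_mul_sub_one_eq_iff hK _ _).2 hz.1)
        ((ceil_mul_sub_one_eq_iff hM _ _).2 hz.2)
    intro n _ n' _ hne
    refine Set.disjoint_left.2 fun z hz hz' => hne ?_
    simpa [Prod.ext_iff] using (hcell hz.2).symm.trans (hcell hz'.2)
  calc ENNReal.ofReal (1 / (K * M)) = volume Q := by
        rw [Measure.volume_eq_prod, Measure.prod_prod, Real.volume_Ioc, Real.volume_Ioc, sub_zero,
          sub_zero, ← ENNReal.ofReal_mul (by positivity), one_div_mul_one_div]
    _ ≤ ∑ n ∈ I, volume ((fun z => z + c n) ⁻¹' (S ∩ (fun z => z - c n) ⁻¹' Q)) :=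
        (measure_mono hcover).trans (measure_biUnion_finset_le _ _)
    _ = volume (⋃ n ∈ I, S ∩ (fun z => z - c n) ⁻¹' Q) := by
        rw [measure_biUnion_finset hdisj fun n _ => hS.inter (by measurability)]
        exact Finset.sum_congr rfl fun n _ => measure_preimage_add_right _ _ _
    _ ≤ squareMeasure S := by
        rw [squareMeasure_eq_volume_inter hS]
        refine measure_mono (Set.iUnion₂_subset fun n hn z hz => ⟨hz.1, ?_⟩)
        obtain ⟨hi, hj⟩ := Finset.mem_product.1 hn
        exact ⟨mem_Ioc_zero_one_of_sub_mem (Finset.mem_range.1 hi) hz.2.1,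
          mem_Ioc_zero_one_of_sub_mem (Finset.mem_range.1 hj) hz.2.2⟩

/-- The points at which `G` jumps by at least `δ` under a shift of its second variable by `s`. -/
def jumpSet (G : ℝ → ℝ → ℂ) (s δ : ℝ) : Set (ℝ × ℝ) := {z | δ ≤ ‖G z.1 (z.2 + s) - G z.1 z.2‖}

theorem jumpSet_anti (G : ℝ → ℝ → ℂ) (s : ℝ) {δ δ' : ℝ} (h : δ ≤ δ') :
    jumpSet G s δ' ⊆ jumpSet G s δ := fun _ hz => h.trans hz

namespace IsQuasiPeriodic

variable {G : ℝ → ℝ → ℂ}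

theorem measurableSet_jumpSet (hG : IsQuasiPeriodic G) (s δ : ℝ) :
    MeasurableSet (jumpSet G s δ) := by
  have hshift : Measurable fun z : ℝ × ℝ => G z.1 (z.2 + s) :=
    hG.measurable.comp (measurable_fst.prodMk (measurable_snd.add_const _))
  exact measurableSet_le measurable_const (hshift.sub hG.measurable).norm

theorem measurableSet_left_jump (hG : IsQuasiPeriodic G) (s δ : ℝ) :
    MeasurableSet {z : ℝ × ℝ | δ ≤ ‖G (z.1 + s) z.2 - G z.1 z.2‖} := by
  have hshift : Measurable fun z : ℝ × ℝ => G (z.1 + s) z.2 :=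
    hG.measurable.comp ((measurable_fst.add_const _).prodMk measurable_snd)
  exact measurableSet_le measurable_const (hshift.sub hG.measurable).norm

end IsQuasiPeriodic

theorem norm_fourierChar_sub_one_le (t : ℝ) : ‖(𝐞 t : ℂ) - 1‖ ≤ 2 * Real.pi * |t| := by
  rw [Real.fourierChar_apply, mul_comm _ Complex.I]
  refine Real.norm_exp_I_mul_ofReal_sub_one_le.trans_eq ?_
  rw [Real.norm_eq_abs, abs_mul, abs_of_pos Real.two_pi_pos]

theorem zakDual_add_right_sub (G : ℝ → ℝ → ℂ) (x y s : ℝ) :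
    zakDual G y (x + s) - zakDual G y x = 𝐞 (x * y) *
      (𝐞 (s * y) * starRingEnd ℂ (G (x + s) y - G x y) +
        (𝐞 (s * y) - 1) * starRingEnd ℂ (G x y)) := by
  rw [zakDual, zakDual, add_mul, AddChar.map_add_eq_mul, Circle.coe_mul,
    map_sub]
  ring

theorem norm_sub_le_norm_zakDual_sub_add (G : ℝ → ℝ → ℂ) {x y s : ℝ} (hs : 0 ≤ s)
    (hy : y ∈ Set.Ioc (0 : ℝ) 1) :
    ‖G (x + s) y - G x y‖ ≤
      ‖zakDual G y (x + s) - zakDual G y x‖ + 2 * Real.pi * s * ‖G x y‖ := by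
  have hphase : ‖(𝐞 (s * y) : ℂ) - 1‖ ≤ 2 * Real.pi * s := by
    refine (norm_fourierChar_sub_one_le _).trans ?_
    rw [abs_of_nonneg (mul_nonneg hs hy.1.le)]
    gcongr
    exact mul_le_of_le_one_right hs hy.2
  calc ‖G (x + s) y - G x y‖
      = ‖(𝐞 (s * y) : ℂ) * starRingEnd ℂ (G (x + s) y - G x y)‖ := by
        rw [norm_mul, Circle.norm_coe, one_mul, RCLike.norm_conj]
    _ ≤ ‖(𝐞 (s * y) : ℂ) * starRingEnd ℂ (G (x + s) y - G x y) +
          (𝐞 (s * y) - 1) * starRingEnd ℂ (G x y)‖ +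
        ‖((𝐞 (s * y) : ℂ) - 1) * starRingEnd ℂ (G x y)‖ := norm_le_add_norm_add _ _
    _ ≤ ‖zakDual G y (x + s) - zakDual G y x‖ + 2 * Real.pi * s * ‖G x y‖ := by
        rw [zakDual_add_right_sub, norm_mul, norm_mul, Circle.norm_coe,
          one_mul, RCLike.norm_conj]
        gcongr

namespace IsQuasiPeriodic

variable {G : ℝ → ℝ → ℂ} {α β δ s : ℝ}

theorem measure_left_jump_le (hG : IsQuasiPeriodic G) (hs : 0 ≤ s)
    (hβ : ∀ᵐ z ∂squareMeasure, ‖Function.uncurry G z‖ ≤ β) (hδ : 2 * Real.pi * s * β ≤ δ) :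
    squareMeasure {z | 2 * δ ≤ ‖G (z.1 + s) z.2 - G z.1 z.2‖} ≤
      squareMeasure (jumpSet (_root_.zakDual G) s δ) := by
  rw [← (Measure.measurePreserving_swap (μ := unitMeasure) (ν := unitMeasure)).measure_preimage
    (hG.zakDual.measurableSet_jumpSet s δ).nullMeasurableSet]
  have hunit : ∀ᵐ z ∂squareMeasure, z.2 ∈ Set.Ioc (0 : ℝ) 1 :=
    Measure.quasiMeasurePreserving_snd.ae (ae_restrict_mem measurableSet_Ioc)
  refine measure_mono_ae ?_
  filter_upwards [hβ, hunit] with ⟨x, y⟩ hbound hy (hjump : 2 * δ ≤ ‖G (x + s) y - G x y‖)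
  change δ ≤ ‖_root_.zakDual G y (x + s) - _root_.zakDual G y x‖
  have hphase : 2 * Real.pi * s * ‖G x y‖ ≤ 2 * Real.pi * s * β := by gcongr; exact hbound
  linarith [norm_sub_le_norm_zakDual_sub_add G (x := x) hs hy]

theorem inv_mul_le_measure_jumpSet_add (hG : IsQuasiPeriodic G)
    (hα : ∀ᵐ z ∂squareMeasure, α ≤ ‖Function.uncurry G z‖)
    (hβ : ∀ᵐ z ∂squareMeasure, ‖Function.uncurry G z‖ ≤ β) (hδ : 0 < δ) (hδα : 6 * δ ≤ α)
    {K M : ℕ} (hK : 0 < K) (hM : 3 ≤ M) (hKβ : 2 * Real.pi * (1 / K) * β ≤ δ) :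
    ENNReal.ofReal (1 / (K * M)) ≤ squareMeasure (jumpSet G (1 / M) δ) +
      squareMeasure (jumpSet (_root_.zakDual G) (1 / K) δ) := by
  let leftJumps : Set (ℝ × ℝ) := {z | 2 * δ ≤ ‖G (z.1 + 1 / K) z.2 - G z.1 z.2‖}
  let rightJumps : Set (ℝ × ℝ) := jumpSet G (1 / M) (2 * δ)
  let small : Set (ℝ × ℝ) := {z | ¬ α ≤ ‖Function.uncurry G z‖}
  have hmeas : MeasurableSet (small ∪ (rightJumps ∪ leftJumps)) :=
    (measurableSet_le measurable_const hG.measurable.norm).compl.union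
      ((hG.measurableSet_jumpSet _ _).union (hG.measurableSet_left_jump _ _))
  have hmem (u v : ℝ) : ∃ i < K, ∃ j < M,
      (u + (i : ℝ) / K, v + (j : ℝ) / M) ∈ small ∪ (rightJumps ∪ leftJumps) := by
    by_contra! hnot
    have hgood : ∀ i < K, ∀ j < M, α ≤ ‖G (u + i / K) (v + j / M)‖ := fun i hi j hj =>
      not_not.1 fun hsmall => hnot i hi j hj (Or.inl hsmall)
    obtain ⟨i, hi, j, hj, hleft | hright⟩ := hG.exists_jump (δ := 2 * δ) (by positivity) hK hM
      fun i hi j hj => (by linarith : 3 * (2 * δ) ≤ α).trans (hgood i hi j hj)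
    · exact hnot i hi j hj (Or.inr (Or.inr hleft))
    · exact hnot i hi j hj (Or.inr (Or.inl hright))
  calc ENNReal.ofReal (1 / (K * M)) ≤ squareMeasure (small ∪ (rightJumps ∪ leftJumps)) :=
        inv_mul_le_squareMeasure hmeas hK (by omega) hmem
    _ ≤ squareMeasure rightJumps + squareMeasure leftJumps := by
        refine (measure_union_le _ _).trans ?_
        rw [show squareMeasure small = 0 from hα, zero_add]
        exact measure_union_le _ _
    _ ≤ squareMeasure (jumpSet G (1 / M) δ) +
          squareMeasure (jumpSet (_root_.zakDual G) (1 / K) δ) := by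
        gcongr ?_ + ?_
        · exact measure_mono (jumpSet_anti G _ (by linarith))
        · exact hG.measure_left_jump_le (by positivity) hβ hKβ

end IsQuasiPeriodic

end Jumps

section Amalgam

theorem lintegral_rpow_tsum_le {X ι : Type*} [Countable ι] [MeasurableSpace X] {μ : Measure X}
    {f : ι → X → ℝ≥0∞} (hf : ∀ i, AEMeasurable (f i) μ) {r : ℝ} (hr : 1 ≤ r) :
    ∫⁻ x, (∑' i, f i x) ^ r ∂μ ≤ (∑' i, eLpNorm (f i) (ENNReal.ofReal r) μ) ^ r := by
  classical
  have hr0 : 0 < r := zero_lt_one.trans_le hr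
  have hsup (x : X) : (∑' i, f i x) ^ r = ⨆ s : Finset ι, (∑ i ∈ s, f i x) ^ r := by
    rw [ENNReal.tsum_eq_iSup_sum]
    exact (ENNReal.orderIsoRpow r hr0).map_iSup _
  have hfinset (s : Finset ι) :
      ∫⁻ x, (∑ i ∈ s, f i x) ^ r ∂μ = eLpNorm (∑ i ∈ s, f i) (ENNReal.ofReal r) μ ^ r := by
    rw [eLpNorm_eq_lintegral_rpow_enorm_toReal (by simpa using hr0) ENNReal.ofReal_ne_top,
      ENNReal.toReal_ofReal hr0.le, ← ENNReal.rpow_mul, one_div_mul_cancel hr0.ne',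
      ENNReal.rpow_one]
    simp only [Finset.sum_apply, enorm_eq_self]
  simp only [hsup]
  rw [lintegral_iSup_directed (fun s => (Finset.aemeasurable_fun_sum s fun i _ => hf i).pow_const r)
    (Monotone.directed_le fun s t hst x =>
      ENNReal.rpow_le_rpow (Finset.sum_le_sum_of_subset hst) hr0.le)]
  refine iSup_le fun s => (hfinset s).trans_le (ENNReal.rpow_le_rpow ?_ hr0.le)
  exact (eLpNorm_sum_le (fun i _ => (hf i).aestronglyMeasurable) (by simpa using hr)).trans
    (ENNReal.sum_le_tsum s)

theorem unitIntervalNorm_eq_eLpNorm_unitMeasure (q : ℝ≥0∞) {f : ℝ → ℂ}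
    (hf : AEStronglyMeasurable f volume) (k : ℤ) :
    unitIntervalNorm q f k = eLpNorm (fun x => f (x + k)) q unitMeasure := by
  have hshift : MeasurePreserving (fun x : ℝ => x + k) unitMeasure
      (volume.restrict (Set.Ioc (k : ℝ) (k + 1))) := by
    simpa using (measurePreserving_add_right volume (k : ℝ)).restrict_preimage
      (measurableSet_Ioc : MeasurableSet (Set.Ioc (k : ℝ) (k + 1)))
  rw [unitIntervalNorm, restrict_Ioo_eq_restrict_Ioc]
  exact (eLpNorm_comp_measurePreserving hf.restrict hshift).symm

theorem unitIntervalNorm_rpow {f : ℝ → ℂ} (hf : AEStronglyMeasurable f volume) {p q : ℝ}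
    (hpq : p.HolderConjugate q) (k : ℤ) :
    unitIntervalNorm (ENNReal.ofReal q) f k ^ p =
      eLpNorm (fun x => ‖f (x + k)‖ₑ ^ p) (ENNReal.ofReal (1 / (p - 1))) unitMeasure := by
  have hexp : ENNReal.ofReal (1 / (p - 1)) * ENNReal.ofReal p = ENNReal.ofReal q := by
    rw [← ENNReal.ofReal_mul (one_div_pos.2 hpq.sub_one_pos).le, hpq.conjugate_eq,
      one_div_mul_eq_div]
  rw [eLpNorm_enorm_rpow _ hpq.pos, hexp, unitIntervalNorm_eq_eLpNorm_unitMeasure _ hf]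

theorem amalgamTail_congr_norm_ae {p q : ℝ≥0∞} {R : ℝ} {f g : ℝ → ℂ}
    (h : ∀ᵐ x, ‖f x‖ = ‖g x‖) : amalgamTail p q R f = amalgamTail p q R g := by
  simp only [amalgamTail, unitIntervalNorm, eLpNorm_congr_norm_ae (ae_restrict_of_ae h)]

theorem lintegral_rpow_tsum_enorm_le_amalgamTail {f : ℝ → ℂ} (hf : AEStronglyMeasurable f volume)
    (R : ℝ) {p q : ℝ} (hpq : p.HolderConjugate q) (hp2 : p ≤ 2) :
    ∫⁻ x, (∑' k : {k : ℤ // R < |(k : ℝ)|}, ‖f (x + k)‖ₑ ^ p) ^ (1 / (p - 1)) ∂unitMeasure ≤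
      amalgamTail (ENNReal.ofReal p) (ENNReal.ofReal q) R f ^ (1 / (p - 1)) := by
  have hr : 1 ≤ 1 / (p - 1) := (one_le_div hpq.sub_one_pos).2 (by linarith)
  have hshift (k : ℤ) : AEStronglyMeasurable (fun x => f (x + k)) unitMeasure :=
    (hf.comp_measurePreserving (measurePreserving_add_right volume (k : ℝ))).restrict
  refine (lintegral_rpow_tsum_le (fun k : {k : ℤ // R < |(k : ℝ)|} =>
    (hshift k).enorm.pow_const p) hr).trans_eq ?_
  simp only [amalgamTail, ENNReal.toReal_ofReal hpq.nonneg, unitIntervalNorm_rpow hf hpq]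

theorem measurable_liftIoc {f : ℝ → ℂ} (hf : Measurable f) :
    Measurable (AddCircle.liftIoc 1 0 f : UnitAddCircle → ℂ) :=
  (hf.comp measurable_subtype_coe).comp (AddCircle.measurableEquivIoc 1 0).measurable

namespace IsQuasiPeriodic

variable {G : ℝ → ℝ → ℂ} {β δ s R p q : ℝ} {N : ℕ}

theorem fourierCoeff_liftIoc (hG : IsQuasiPeriodic G) (x : ℝ) (k : ℤ) :
    fourierCoeff (AddCircle.liftIoc 1 0 (G x) : UnitAddCircle → ℂ) k =
      zakInv G (x + (-k : ℤ)) := by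
  rw [_root_.fourierCoeff_liftIoc, hG.zakInv_add_intCast, Int.cast_neg]

theorem unitMeasure_jump_le (hG : IsQuasiPeriodic G) {x : ℝ}
    (hβ : ∀ᵐ y ∂unitMeasure, ‖G x y‖ ≤ β) (hδ : 0 < δ) (hN : N ≠ 0)
    (hs : 80 * β * N * ‖(s : UnitAddCircle)‖ ≤ δ) (hR : R < N + 1) (hp : 1 < p) (hp2 : p ≤ 2) :
    unitMeasure {y | δ ≤ ‖G x (y + s) - G x y‖} ≤ ENNReal.ofReal (16 / δ) *
      (ENNReal.ofReal (8 / δ) *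
        ∑' k : {k : ℤ // R < |(k : ℝ)|}, ‖zakInv G (x + k)‖ₑ ^ p) ^ (1 / (p - 1)) := by
  let F : UnitAddCircle → ℂ := AddCircle.liftIoc 1 0 (G x)
  have hF : Measurable F := measurable_liftIoc (hG.measurable_right x)
  have hFcoe (y : ℝ) : F y = G x y := liftIoc_coe_of_periodic (hG.add_one_right x) y
  have hFβ : ∀ᵐ t ∂AddCircle.haarAddCircle, ‖F t‖ ≤ β := by
    rw [← measurePreserving_coe_unitMeasure.map_eq,
      ae_map_iff measurePreserving_coe_unitMeasure.aemeasurable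
        (measurableSet_le hF.norm measurable_const)]
    simpa only [hFcoe] using hβ
  have hset : unitMeasure {y | δ ≤ ‖G x (y + s) - G x y‖} =
      AddCircle.haarAddCircle {t : UnitAddCircle | δ ≤ ‖F (t + s) - F t‖} := by
    have hmeas : MeasurableSet {t : UnitAddCircle | δ ≤ ‖F (t + s) - F t‖} :=
      measurableSet_le measurable_const ((hF.comp (measurable_add_const _)).sub hF).norm
    rw [← measurePreserving_coe_unitMeasure.measure_preimage hmeas.nullMeasurableSet]
    simp only [Set.preimage_ofPred_eq, ← AddCircle.coe_add, hFcoe]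
  have htail (k : {k : ℤ // (N : ℤ) < |k|}) : R < |((-k : ℤ) : ℝ)| := by
    refine hR.trans_le ?_
    rw [Int.cast_neg, abs_neg]
    exact_mod_cast Int.add_one_le_iff.2 k.2
  rw [hset]
  refine (meas_translate_sub_ge_le hF.aestronglyMeasurable hFβ hδ hN hs hp hp2).trans ?_
  gcongr
  simp only [F, hG.fourierCoeff_liftIoc]
  exact ENNReal.tsum_comp_le_tsum_of_injective (f := fun k => ⟨-k.1, htail k⟩)
    (fun k l hkl => Subtype.ext (neg_injective (congrArg Subtype.val hkl)))
    (fun k : {k : ℤ // R < |(k : ℝ)|} => ‖zakInv G (x + k)‖ₑ ^ p)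

theorem measure_jumpSet_le (hG : IsQuasiPeriodic G)
    (hβ : ∀ᵐ z ∂squareMeasure, ‖Function.uncurry G z‖ ≤ β) (hδ : 0 < δ) (hN : N ≠ 0)
    (hs : 80 * β * N * ‖(s : UnitAddCircle)‖ ≤ δ) (hR : R < N + 1) (hpq : p.HolderConjugate q)
    (hp2 : p ≤ 2) :
    squareMeasure (jumpSet G s δ) ≤ ENNReal.ofReal (16 / δ) * (ENNReal.ofReal (8 / δ) *
      amalgamTail (ENNReal.ofReal p) (ENNReal.ofReal q) R (zakInv G)) ^ (1 / (p - 1)) := by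
  have hr : 0 ≤ 1 / (p - 1) := (one_div_pos.2 hpq.sub_one_pos).le
  have hmeas (k : ℤ) : Measurable fun x => zakInv G (x + k) :=
    hG.measurable_zakInv.comp (measurable_add_const _)
  have htail : Measurable fun x => (∑' k : {k : ℤ // R < |(k : ℝ)|}, ‖zakInv G (x + k)‖ₑ ^ p) :=
    Measurable.tsum fun k => (hmeas k).enorm.pow_const p
  rw [Measure.prod_apply (hG.measurableSet_jumpSet s δ)]
  calc ∫⁻ x, unitMeasure (Prod.mk x ⁻¹' jumpSet G s δ) ∂unitMeasure
      ≤ ∫⁻ x, ENNReal.ofReal (16 / δ) * (ENNReal.ofReal (8 / δ) *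
          ∑' k : {k : ℤ // R < |(k : ℝ)|}, ‖zakInv G (x + k)‖ₑ ^ p) ^ (1 / (p - 1)) ∂unitMeasure :=
        lintegral_mono_ae ((Measure.ae_ae_of_ae_prod hβ).mono fun x hx =>
          hG.unitMeasure_jump_le hx hδ hN hs hR hpq.lt hp2)
    _ = ENNReal.ofReal (16 / δ) * (ENNReal.ofReal (8 / δ) ^ (1 / (p - 1)) * ∫⁻ x,
          (∑' k : {k : ℤ // R < |(k : ℝ)|}, ‖zakInv G (x + k)‖ₑ ^ p) ^ (1 / (p - 1))
            ∂unitMeasure) := by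
        simp only [ENNReal.mul_rpow_of_nonneg _ _ hr]
        rw [lintegral_const_mul _ ((htail.pow_const _).const_mul _),
          lintegral_const_mul _ (htail.pow_const _)]
    _ ≤ _ := by
        rw [ENNReal.mul_rpow_of_nonneg _ _ hr]
        gcongr
        exact lintegral_rpow_tsum_enorm_le_amalgamTail
          hG.measurable_zakInv.aestronglyMeasurable R hpq hp2

end IsQuasiPeriodic

end Amalgam

section Estimates

theorem norm_coe_unitAddCircle_le (s : ℝ) : ‖(s : UnitAddCircle)‖ ≤ |s| := by
  simpa [UnitAddCircle.norm_eq] using round_le s 0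

theorem ae_norm_zakDual_le {G : ℝ → ℝ → ℂ} {β : ℝ}
    (hβ : ∀ᵐ z ∂squareMeasure, ‖Function.uncurry G z‖ ≤ β) :
    ∀ᵐ z ∂squareMeasure, ‖Function.uncurry (_root_.zakDual G) z‖ ≤ β := by
  filter_upwards [Measure.measurePreserving_swap.quasiMeasurePreserving.ae hβ] with z hz
  simpa only [Function.uncurry, norm_zakDual, Prod.fst_swap, Prod.snd_swap] using hz

theorem mul_norm_one_div_natCast_mul_le {β δ : ℝ} (hβ : 0 ≤ β) {m N : ℕ} (hm : m ≠ 0) (hN : N ≠ 0)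
    (h : 80 * β ≤ δ * m) :
    80 * β * N * ‖((1 / (m * N : ℕ) : ℝ) : UnitAddCircle)‖ ≤ δ :=
  calc _ ≤ 80 * β * N * |1 / ((m * N : ℕ) : ℝ)| := by
        gcongr
        exact norm_coe_unitAddCircle_le _
    _ = 80 * β / m := by
        rw [abs_of_nonneg (by positivity)]
        push_cast
        field_simp
    _ ≤ δ := by rwa [div_le_iff₀ (by positivity)]

theorem two_pi_mul_one_div_natCast_mul_le {β δ : ℝ} (hβ : 0 ≤ β) {m K : ℕ} (hm : m ≠ 0)
    (hK : K ≠ 0) (h : 80 * β ≤ δ * m) : 2 * Real.pi * (1 / (m * K : ℕ)) * β ≤ δ :=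
  calc 2 * Real.pi * (1 / (m * K : ℕ)) * β ≤ 80 * (1 / (m * 1 : ℕ)) * β := by
        gcongr
        · linarith [Real.pi_le_four]
        · exact Nat.one_le_iff_ne_zero.2 hK
    _ = 80 * β / m := by push_cast; ring
    _ ≤ δ := by rwa [div_le_iff₀ (by positivity)]

theorem IsQuasiPeriodic.inv_le_amalgamTail_add {G : ℝ → ℝ → ℂ} (hG : IsQuasiPeriodic G)
    {α β δ : ℝ} (hα : ∀ᵐ z ∂squareMeasure, α ≤ ‖Function.uncurry G z‖)
    (hβ : ∀ᵐ z ∂squareMeasure, ‖Function.uncurry G z‖ ≤ β) (hβ0 : 0 ≤ β) (hδ : 0 < δ)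
    (hδα : 6 * δ ≤ α) {m : ℕ} (hm : 3 ≤ m) (hmβ : 80 * β ≤ δ * m) {R L : ℝ} (hR : 1 ≤ R)
    (hL : 1 ≤ L) {p q : ℝ} (hpq : p.HolderConjugate q) (hp2 : p ≤ 2) :
    ENNReal.ofReal (1 / (m ^ 2 * (R * L))) ≤ ENNReal.ofReal (32 / δ) * (ENNReal.ofReal (8 / δ) *
      (amalgamTail (ENNReal.ofReal p) (ENNReal.ofReal q) R (zakInv G) +
        amalgamTail (ENNReal.ofReal p) (ENNReal.ofReal q) L (zakInv (_root_.zakDual G)))) ^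
          (1 / (p - 1)) := by
  let N := ⌊R⌋₊
  let K := ⌊L⌋₊
  have hN : 0 < N := Nat.floor_pos.2 hR
  have hK : 0 < K := Nat.floor_pos.2 hL
  have hm0 : m ≠ 0 := by omega
  have hjump := hG.inv_mul_le_measure_jumpSet_add hα hβ hδ hδα (K := m * K) (M := m * N)
    (by positivity) (by nlinarith) (two_pi_mul_one_div_natCast_mul_le hβ0 hm0 hK.ne' hmβ)
  have hp : 0 ≤ 1 / (p - 1) := one_div_nonneg.2 hpq.sub_one_pos.le
  have hGR := hG.measure_jumpSet_le hβ hδ hN.ne'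
    (mul_norm_one_div_natCast_mul_le hβ0 hm0 hN.ne' hmβ) (Nat.lt_floor_add_one R) hpq hp2
  have hGL := hG.zakDual.measure_jumpSet_le (ae_norm_zakDual_le hβ) hδ hK.ne'
    (mul_norm_one_div_natCast_mul_le hβ0 hm0 hK.ne' hmβ) (Nat.lt_floor_add_one L) hpq hp2
  calc ENNReal.ofReal (1 / (m ^ 2 * (R * L)))
      ≤ ENNReal.ofReal (1 / ((m * K : ℕ) * (m * N : ℕ))) := by
        refine ENNReal.ofReal_le_ofReal (one_div_le_one_div_of_le (by positivity) ?_)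
        calc ((m * K : ℕ) * (m * N : ℕ) : ℝ) = m ^ 2 * (N * K) := by push_cast; ring
          _ ≤ m ^ 2 * (R * L) := by
            gcongr
            exacts [Nat.floor_le (by positivity), Nat.floor_le (by positivity)]
    _ ≤ _ := hjump
    _ ≤ _ := add_le_add
      (hGR.trans (mul_le_mul_right
        (ENNReal.rpow_le_rpow (mul_le_mul_right le_self_add _) hp) _))
      (hGL.trans (mul_le_mul_right
        (ENNReal.rpow_le_rpow (mul_le_mul_right le_add_self _) hp) _))
    _ = _ := by
      rw [← add_mul, ← ENNReal.ofReal_add (by positivity) (by positivity)]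
      congr 2
      ring

theorem ofReal_le_ofReal_mul_iff {a x : ℝ} {S : ℝ≥0∞} (ha : 0 < a) :
    ENNReal.ofReal x ≤ ENNReal.ofReal a * S ↔ ENNReal.ofReal (x / a) ≤ S := by
  rw [ENNReal.ofReal_div_of_pos ha, ENNReal.div_le_iff' (ENNReal.ofReal_pos.2 ha).ne'
    ENNReal.ofReal_ne_top]

theorem amalgamTail_le_amalgamTail_one_top {f : ℝ → ℂ} (hf : AEStronglyMeasurable f volume)
    {R : ℝ} (h : amalgamTail 1 ∞ R f ≤ 1) {p : ℝ} (hp : 1 ≤ p) (q : ℝ≥0∞) :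
    amalgamTail (ENNReal.ofReal p) q R f ≤ amalgamTail 1 ∞ R f := by
  have hq (k : ℤ) : unitIntervalNorm q f k ≤ unitIntervalNorm ∞ f k := by
    simp only [unitIntervalNorm_eq_eLpNorm_unitMeasure _ hf]
    exact eLpNorm_le_eLpNorm_of_exponent_le le_top (hf.comp_measurePreserving
      (measurePreserving_add_right volume (k : ℝ))).restrict
  simp only [amalgamTail, ENNReal.toReal_one, ENNReal.rpow_one,
    ENNReal.toReal_ofReal (zero_le_one.trans hp)] at h ⊢
  refine ENNReal.tsum_le_tsum fun k => ?_
  exact (hq k).trans' <|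
    ENNReal.rpow_le_self_of_le_one ((hq k).trans ((ENNReal.le_tsum k).trans h)) hp

theorem ofReal_div_rpow_le_of_le_rpow {c X r : ℝ} {S : ℝ≥0∞} (hc : 0 < c) (hc1 : c ≤ 1)
    (hX : 0 < X) (hr : 0 < r) (hr1 : r ≤ 1) (h : ENNReal.ofReal (c / X) ≤ S ^ (1 / r)) :
    ENNReal.ofReal (c / X ^ r) ≤ S :=
  calc ENNReal.ofReal (c / X ^ r) ≤ ENNReal.ofReal ((c / X) ^ r) := by
        rw [Real.div_rpow hc.le hX.le]
        gcongr
        exact Real.self_le_rpow_of_le_one hc.le hc1 hr1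
    _ ≤ (S ^ (1 / r)) ^ r := by
        rw [← ENNReal.ofReal_rpow_of_pos (by positivity)]
        gcongr
    _ = S := by rw [← ENNReal.rpow_mul, one_div_mul_cancel hr.ne', ENNReal.rpow_one]

theorem exists_le_amalgamTail_add {A : ℝ} (hA : 0 < A) (B : ℝ) : ∃ C : ℝ, 0 < C ∧
    ∀ g : Lp ℂ 2 (volume : Measure ℝ), IsRieszBasisWithBounds A B (gaborSystem g) →
      ∀ p q : ℝ, p.HolderConjugate q → p ≤ 2 → ∀ R L : ℝ, 1 ≤ R → 1 ≤ L →
        ENNReal.ofReal (C / (R * L) ^ (p - 1)) ≤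
          amalgamTail (ENNReal.ofReal p) (ENNReal.ofReal q) R g +
          amalgamTail (ENNReal.ofReal p) (ENNReal.ofReal q) L
            (𝓕 g : Lp ℂ 2 (volume : Measure ℝ)) := by
  let δ := √A / 6
  have hδ : 0 < δ := by positivity
  let m := ⌈80 * √B / δ⌉₊ + 3
  have hm : (0 : ℝ) < m := by positivity
  have hmB : 80 * √B ≤ δ * m := by
    rw [← div_le_iff₀' hδ]
    exact (Nat.le_ceil _).trans (by simp [m])
  let c := min 1 (δ / (32 * m ^ 2))
  have hc : 0 < c := by positivity
  refine ⟨c / (8 / δ), by positivity, fun g hg p q hpq hp2 R L hR hL => ?_⟩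
  obtain ⟨G, hG, hGg, hGF⟩ := exists_zakInv_eq g
  have hGg : zakInv G =ᵐ[volume] g := hGg ▸ hG.memLp_zakInv.coeFn_toLp.symm
  have hGF : zakInv (zakDual G) =ᵐ[volume] star (𝓕 g : Lp ℂ 2 (volume : Measure ℝ)) :=
    (hG.zakDual.memLp_zakInv.coeFn_toLp.symm.trans (by rw [hGF])).trans (Lp.coeFn_star _)
  have hb := hG.ae_bounds hGg hg
  have hjump := hG.inv_le_amalgamTail_add (hb.mono fun _ h => h.1) (hb.mono fun _ h => h.2)
    B.sqrt_nonneg hδ (by simp only [δ]; linarith) (by omega) hmB hR hL hpq hp2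
  rw [amalgamTail_congr_norm_ae (hGg.mono fun _ h => congrArg norm h),
    amalgamTail_congr_norm_ae (hGF.mono fun _ h => (congrArg norm h).trans (norm_star _))] at hjump
  rw [ofReal_le_ofReal_mul_iff (by positivity)] at hjump
  rw [div_right_comm, ← ofReal_le_ofReal_mul_iff (by positivity)]
  refine ofReal_div_rpow_le_of_le_rpow hc (min_le_left _ _) (X := R * L) (by positivity)
    hpq.sub_one_pos (by linarith) (le_trans (ENNReal.ofReal_le_ofReal ?_) hjump)
  calc c / (R * L) ≤ δ / (32 * m ^ 2) / (R * L) := by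
        gcongr
        exact min_le_right _ _
    _ = 1 / (m ^ 2 * (R * L)) / (32 / δ) := by field_simp

end Estimates

section Endpoints

open Filter Topology

theorem ofReal_min_one_le_amalgamTail_one_top_add {f g : ℝ → ℂ}
    (hf : AEStronglyMeasurable f volume) (hg : AEStronglyMeasurable g volume) {C R L X : ℝ}
    (hX : 0 < X) (h : ∀ p q : ℝ, p.HolderConjugate q → p ≤ 2 → ENNReal.ofReal (C / X ^ (p - 1)) ≤
      amalgamTail (ENNReal.ofReal p) (ENNReal.ofReal q) R f +
        amalgamTail (ENNReal.ofReal p) (ENNReal.ofReal q) L g) :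
    ENNReal.ofReal (min C 1) ≤ amalgamTail 1 ∞ R f + amalgamTail 1 ∞ L g := by
  rcases le_total (amalgamTail 1 ∞ R f + amalgamTail 1 ∞ L g) 1 with hle | hge
  · have hbound : ∀ᶠ p in 𝓝[>] (1 : ℝ), ENNReal.ofReal (C / X ^ (p - 1)) ≤
        amalgamTail 1 ∞ R f + amalgamTail 1 ∞ L g := by
      filter_upwards [Ioc_mem_nhdsGT one_lt_two] with p hp
      refine (h p _ (.conjExponent hp.1) hp.2).trans (add_le_add ?_ ?_)
      · exact amalgamTail_le_amalgamTail_one_top hf (le_self_add.trans hle) hp.1.le _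
      · exact amalgamTail_le_amalgamTail_one_top hg (le_add_self.trans hle) hp.1.le _
    have hlim : Tendsto (fun p : ℝ => ENNReal.ofReal (C / X ^ (p - 1))) (𝓝[>] 1)
        (𝓝 (ENNReal.ofReal (C / X ^ ((1 : ℝ) - 1)))) := by
      refine ENNReal.tendsto_ofReal ((ContinuousAt.tendsto ?_).mono_left nhdsWithin_le_nhds)
      fun_prop (disch := positivity)
    rw [sub_self, Real.rpow_zero, div_one] at hlim
    exact (ENNReal.ofReal_le_ofReal (min_le_left _ _)).trans (le_of_tendsto hlim hbound)
  · exact (ENNReal.ofReal_le_one.2 (min_le_right _ _)).trans hge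

theorem exists_lt_amalgamTail_add {A : ℝ} (hA : 0 < A) (B : ℝ) : ∃ C : ℝ, 0 < C ∧
    ∀ g : Lp ℂ 2 (volume : Measure ℝ), IsRieszBasisWithBounds A B (gaborSystem g) →
      ∀ p q : ℝ≥0∞, p.HolderConjugate q → p ≤ 2 → ∀ R L : ℝ, 1 ≤ R → 1 ≤ L →
        ENNReal.ofReal (C / (R * L) ^ (p / q).toReal) <
          amalgamTail p q R g + amalgamTail p q L (𝓕 g : Lp ℂ 2 (volume : Measure ℝ)) := by
  obtain ⟨C, hC, hbound⟩ := exists_le_amalgamTail_add hA B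
  refine ⟨min C 1 / 2, by positivity, fun g hg p q hpq hp2 R L hR hL => ?_⟩
  have hX : 0 < R * L := by positivity
  suffices h : ENNReal.ofReal (min C 1 / (R * L) ^ (p / q).toReal) ≤
      amalgamTail p q R g + amalgamTail p q L (𝓕 g : Lp ℂ 2 (volume : Measure ℝ)) by
    refine (ENNReal.ofReal_lt_ofReal_iff (by positivity)).2 ?_ |>.trans_le h
    gcongr
    exact half_lt_self (by positivity)
  by_cases hq : q = ∞
  · obtain rfl : p = 1 := by
      by_contra hp
      exact (ENNReal.HolderConjugate.ne_top_iff_ne_one q p).2 hp hq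
    subst hq
    rw [ENNReal.div_top, ENNReal.toReal_zero, Real.rpow_zero, div_one]
    exact ofReal_min_one_le_amalgamTail_one_top_add (Lp.aestronglyMeasurable _)
      (Lp.aestronglyMeasurable _) hX fun p q hpq hp2 => hbound g hg p q hpq hp2 R L hR hL
  · have hp : p ≠ ∞ := (hp2.trans_lt ENNReal.ofNat_lt_top).ne
    have hconj := ENNReal.HolderConjugate.toReal_of_ne_top hp hq
    have h := hbound g hg _ _ hconj (ENNReal.toReal_mono ENNReal.ofNat_ne_top hp2) R L hR hL
    rw [ENNReal.ofReal_toReal hp, ENNReal.ofReal_toReal hq] at h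
    refine le_trans (ENNReal.ofReal_le_ofReal ?_) h
    rw [ENNReal.toReal_div, hconj.div_conj_eq_sub_one]
    gcongr
    exact min_le_left _ _

theorem amalgamTail_two_two_le_setLIntegral (f : ℝ → ℂ) (R : ℝ) :
    amalgamTail 2 2 (R + 1) f ≤ ∫⁻ t in {t : ℝ | R ≤ |t|}, ‖f t‖ₑ ^ 2 := by
  have hnorm (k : ℤ) : unitIntervalNorm 2 f k ^ (2 : ℝ≥0∞).toReal =
      ∫⁻ t in Set.Ioo (k : ℝ) (k + 1), ‖f t‖ₑ ^ 2 := by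
    rw [unitIntervalNorm, eLpNorm_eq_lintegral_rpow_enorm_toReal two_ne_zero ENNReal.ofNat_ne_top,
      ← ENNReal.rpow_mul]
    simp
  have hdisj : Pairwise (Function.onFun Disjoint
      fun k : {k : ℤ // R + 1 < |(k : ℝ)|} => Set.Ioo ((k : ℤ) : ℝ) ((k : ℤ) + 1)) :=
    fun i j hij => (Set.pairwise_disjoint_Ioc_intCast ℝ (Subtype.coe_injective.ne hij)).mono
      Set.Ioo_subset_Ioc_self Set.Ioo_subset_Ioc_self
  simp only [amalgamTail, hnorm]
  rw [← lintegral_iUnion (fun _ => measurableSet_Ioo) hdisj]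
  refine lintegral_mono_set (Set.iUnion_subset fun k t ht => ?_)
  rw [Set.mem_ofPred_eq, le_abs]
  rcases lt_abs.1 k.2 with hk | hk
  · exact .inl (by linarith [ht.1])
  · exact .inr (by linarith [ht.2])

theorem exists_amalgamTail_one_lt {q : ℝ≥0∞} {f : ℝ → ℂ}
    (hf : ∑' k : ℤ, unitIntervalNorm q f k ≠ ∞) {c : ℝ≥0∞} (hc : 0 < c) :
    ∃ R : ℝ, 1 ≤ R ∧ amalgamTail 1 q R f < c := by
  obtain ⟨s, hs⟩ := ((ENNReal.tendsto_tsum_compl_atTop_zero hf).eventually (gt_mem_nhds hc)).exists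
  let R : ℝ := 1 + ∑ k ∈ s, |(k : ℝ)|
  have hR (k : ℤ) (hk : R < |(k : ℝ)|) : k ∉ s := by
    intro hks
    linarith [Finset.single_le_sum (f := fun k : ℤ => |(k : ℝ)|) (fun _ _ => abs_nonneg _) hks]
  refine ⟨R, le_add_of_nonneg_right (Finset.sum_nonneg fun _ _ => abs_nonneg _), hs.trans_le' ?_⟩
  simp only [amalgamTail, ENNReal.toReal_one, ENNReal.rpow_one]
  exact ENNReal.tsum_mono_subtype (unitIntervalNorm q f) hR

end Endpoints

/-- Here `𝓕 g` is the Fourier transform of `L²(ℝ)`, normalised by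
`𝓕 g (ξ) = ∫ g(t) e^{-2πiξt} dt` on integrable functions. -/
theorem mainTheorem5 (A B : ℝ) (hA : 0 < A) (hB : 0 < B) :
    ∃ C : ℝ, 0 < C ∧
      ∀ g : Lp ℂ 2 (volume : Measure ℝ), IsRieszBasisWithBounds A B (gaborSystem g) →
        -- the interpolating estimate
        (∀ p q : ℝ≥0∞, 1 ≤ p → p ≤ 2 → 1 / p + 1 / q = 1 →
          ∀ R L : ℝ, 1 ≤ R → 1 ≤ L →
            ENNReal.ofReal (C / (R * L) ^ (p / q).toReal) <
              amalgamTail p q R g + amalgamTail p q L (𝓕 g : Lp ℂ 2 (volume : Measure ℝ))) ∧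
        -- the estimate that the case `p = q = 2` recovers
        (∀ R L : ℝ, 1 ≤ R → 1 ≤ L →
          ENNReal.ofReal (C / (R * L)) ≤
            (∫⁻ t in {t : ℝ | R ≤ |t|}, ‖g t‖ₑ ^ 2) +
              ∫⁻ ξ in {ξ : ℝ | L ≤ |ξ|}, ‖(𝓕 g : Lp ℂ 2 (volume : Measure ℝ)) ξ‖ₑ ^ 2) ∧
        -- the dichotomy that the case `p = 1`, `q = ∞` recovers
        (∑' k : ℤ, unitIntervalNorm ∞ g k = ∞ ∨
          ∑' k : ℤ, unitIntervalNorm ∞ (𝓕 g : Lp ℂ 2 (volume : Measure ℝ)) k = ∞) := by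
  obtain ⟨C, hC, hbound⟩ := exists_lt_amalgamTail_add hA B
  refine ⟨C / 4, by positivity, fun g hg => ⟨fun p q _ hp2 hpq R L hR hL => ?_,
    fun R L hR hL => ?_, ?_⟩⟩
  · refine lt_of_le_of_lt (ENNReal.ofReal_le_ofReal ?_)
      (hbound g hg p q ⟨by simpa using hpq⟩ hp2 R L hR hL)
    gcongr
    linarith
  · refine le_trans (ENNReal.ofReal_le_ofReal ?_)
      ((hbound g hg 2 2 inferInstance le_rfl (R + 1) (L + 1) (by linarith) (by linarith)).le.trans
        (add_le_add (amalgamTail_two_two_le_setLIntegral _ R)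
          (amalgamTail_two_two_le_setLIntegral _ L)))
    rw [ENNReal.div_self two_ne_zero ENNReal.ofNat_ne_top, ENNReal.toReal_one, Real.rpow_one,
      div_div]
    exact div_le_div_of_nonneg_left hC.le (by positivity) (by nlinarith)
  · by_contra! hfin
    have hpos : 0 < ENNReal.ofReal C / 2 := ENNReal.half_pos (ENNReal.ofReal_pos.2 hC).ne'
    obtain ⟨R, hR, hgR⟩ := exists_amalgamTail_one_lt hfin.1 hpos
    obtain ⟨L, hL, hgL⟩ := exists_amalgamTail_one_lt hfin.2 hpos
    have hlt := hbound g hg 1 ∞ .one_top one_le_two R L hR hL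
    rw [ENNReal.div_top, ENNReal.toReal_zero, Real.rpow_zero, div_one] at hlt
    exact (hlt.trans (ENNReal.add_lt_add hgR hgL)).ne (ENNReal.add_halves _).symm
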